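/- For positive integers $k,d,n$ let $f_{k,d}(n)$ denote the maximal size of a set $A\subseteq\{1,2,\dots,n\}$ such that the equation \[a_1a_2\cdots a_k=x^d\] has no solution with $a_1,\dots,a_k\in A$ (not necessarily distinct) and $x$ an integer, except trivial solutions; a solution is called trivial if the multiset $\{a_1,\dots,a_k\}$ can be partitioned into $d$-tuples each of which consists of $d$ copies of the same number. Let $\pi(n)$ denote the number of primes not exceeding $n$. Theorem. There exist positive constants $c_1$ and $c_2$ such that for every integer $n\ge 2$ \[c_1\frac{n^{3/4}}{(\log n)^{3/2}}<f_{6,3}(n)-\pi(n)<c_2\frac{n^{3/4}}{(\log n)^{3/2}}.\] -/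

import Mathlib

/-- A finite family `a₁, …, a_k` is trivial (with respect to `d`) if the multiset of its values can
be partitioned into `d`-tuples, each consisting of `d` copies of one number; `t` lists the
numbers that are repeated, one for each `d`-tuple. -/
def IsTrivialFamily {k : ℕ} (d : ℕ) (a : Fin k → ℕ) : Prop :=
  ∃ t : Multiset ℕ,
    Multiset.map a Finset.univ.val = t.bind (fun b => Multiset.replicate d b)

/-- The family of sets `A` of positive integers in which the equation `a₁ a₂ ⋯ a_k = x ^ d`
(`a_i ∈ A` not necessarily distinct, `x` an integer) has only trivial solutions. -/
def gammaFamily (k d : ℕ) : Set (Set ℕ) :=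
  {A | (∀ m ∈ A, 0 < m) ∧
    ∀ a : Fin k → ℕ, (∀ i, a i ∈ A) → (∃ x : ℤ, ∏ i, (a i : ℤ) = x ^ d) → IsTrivialFamily d a}

open Classical in
/-- The maximal size of a set `A ⊆ {1, …, n}` that belongs to `gammaFamily k d`. -/
noncomputable def fMax (k d n : ℕ) : ℕ :=
  ((Finset.Icc 1 n).powerset.filter (fun A : Finset ℕ => (A : Set ℕ) ∈ gammaFamily k d)).sup Finset.card

/-- The empty set is always admissible, so that `fMax` is a maximum over a nonempty family. -/
theorem empty_mem_gammaFamily (k d : ℕ) : (∅ : Set ℕ) ∈ gammaFamily k d := by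
  refine ⟨by simp, fun a ha _ => ?_⟩
  cases k with
  | zero => exact ⟨0, by simp⟩
  | succ k => exact absurd (ha 0) (by simp)

/-- `fMax k d n` is attained. -/
theorem isGreatest_fMax (k d n : ℕ) :
    IsGreatest {m | ∃ A : Finset ℕ,
      A ⊆ Finset.Icc 1 n ∧ (A : Set ℕ) ∈ gammaFamily k d ∧ A.card = m} (fMax k d n) := by
  classical
  constructor
  · obtain ⟨A, hA, h⟩ := Finset.exists_mem_eq_sup
      ((Finset.Icc 1 n).powerset.filter (fun A : Finset ℕ => (A : Set ℕ) ∈ gammaFamily k d))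
      ⟨∅, by simpa using empty_mem_gammaFamily k d⟩ Finset.card
    rw [Finset.mem_filter, Finset.mem_powerset] at hA
    refine ⟨A, hA.1, hA.2, ?_⟩
    rw [← h, fMax]
  · rintro m ⟨A, h1, h2, rfl⟩
    unfold fMax
    apply Finset.le_sup (f := Finset.card)
    simp only [Finset.mem_filter, Finset.mem_powerset]
    exact ⟨h1, h2⟩

/-! Upper bound. If ab = cd with a different from c and d, then a·b·c·c·d·d = (ab)^3 is a nontrivial
solution, so an admissible set is multiplicatively Sidon and Erdős's method applies. Factorizations
uv of its members are edges of a bipartite graph, rectangles are forbidden, and double counting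
bounds the edges by |U| + |V|^2 or |U| + |V|√|U|. With w = n^(1/80), `rough_trichotomy` sorts the
members into three classes. Those with a prime factor above w^56 number at most π(n) + w^48; those
with a balanced factorization number O(w^59). The rest are products m·s·t where s and t have one or
two prime factors, all above w^12. There s and t both range over sets of density O(1/log n), so
|V|√|U| gains (log n)^(3/2), and summing over 16-adic ranges of m and s costs only a constant.

Lower bound. Take 1, the primes in (√n, n], and products of two primes up to √n along the edges of a
point-line incidence graph over `ZMod p`, with 2p^2 ≤ π(√n). For p^2 of order π(√n) its p^3 edges
have order n^(3/4)/(log n)^(3/2), which outweighs the π(√n) primes given up. In a solution the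
products form a multigraph with at most six edges and all degrees divisible by 3
(`three_dvd_card_of_rectangle_free`). Edges of multiplicity not divisible by 3 would contain a
cycle; without rectangles it has three vertices on one side, each of degree at least 3, hence nine
edges. -/

/-- A set of naturals in which `a * b = c * d` has only the obvious solutions. -/
def MulSidon (A : Set ℕ) : Prop :=
  ∀ a ∈ A, ∀ b ∈ A, ∀ c ∈ A, ∀ d ∈ A, a * b = c * d → a = c ∨ a = d

/-! ### Trivial families, multiplicities and the Sidon property -/

theorem IsTrivialFamily.dvd_card {k d : ℕ} {a : Fin k → ℕ} (h : IsTrivialFamily d a) (x : ℕ) :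
    d ∣ (Finset.univ.filter fun i => a i = x).card := by
  obtain ⟨t, ht⟩ := h
  have h1 : Multiset.count x (Multiset.map a Finset.univ.val)
      = (Finset.univ.filter fun i => a i = x).card := by
    rw [Multiset.count_map]
    simp [Finset.card, eq_comm]
  rw [← h1, ht, Multiset.count_bind]
  apply Multiset.dvd_sum
  intro y hy
  obtain ⟨b, -, rfl⟩ := Multiset.mem_map.1 hy
  rw [Multiset.count_replicate]
  split_ifs <;> simp

theorem isTrivialFamily_of_dvd_card {k d : ℕ} {a : Fin k → ℕ}
    (h : ∀ x, d ∣ (Finset.univ.filter fun i => a i = x).card) : IsTrivialFamily d a := by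
  classical
  refine ⟨∑ x ∈ Finset.univ.image a,
    Multiset.replicate ((Finset.univ.filter fun i => a i = x).card / d) x, ?_⟩
  ext y
  have h1 : Multiset.count y (Multiset.map a Finset.univ.val)
      = (Finset.univ.filter fun i => a i = y).card := by
    rw [Multiset.count_map]
    simp [Finset.card, eq_comm]
  have h2 : ∀ t : Multiset ℕ, Multiset.count y (t.bind fun b => Multiset.replicate d b)
      = t.count y * d := by
    intro t
    induction t using Multiset.induction_on with
    | empty => simp
    | cons b t ih =>
      rw [Multiset.cons_bind, Multiset.count_add, ih, Multiset.count_replicate,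
        Multiset.count_cons]
      by_cases hb : b = y
      · subst hb; simp; ring
      · simp [hb, Ne.symm hb]
  rw [h1, h2, Multiset.count_sum']
  simp_rw [Multiset.count_replicate]
  rw [Finset.sum_ite_eq' (Finset.univ.image a) y]
  split_ifs with hy
  · exact (Nat.div_mul_cancel (h y)).symm
  · rw [zero_mul, Finset.card_eq_zero, Finset.filter_eq_empty_iff]
    intro i _ hi
    exact hy (Finset.mem_image.2 ⟨i, Finset.mem_univ _, hi⟩)

theorem mulSidon_of_mem_gammaFamily {A : Set ℕ} (hA : A ∈ gammaFamily 6 3) : MulSidon A := by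
  intro a ha b hb c hc d hd h
  by_contra hne
  push Not at hne
  -- The product is ab(cd)^2 = (ab)^3, while a, being neither c nor d, occurs only once or twice.
  have ht := hA.2 ![a, b, c, c, d, d]
    (by intro i; fin_cases i <;> assumption)
    ⟨(a * b : ℕ), by
      have : (a : ℤ) * b = c * d := by exact_mod_cast h
      simp only [Fin.prod_univ_succ]
      simp
      linear_combination (-(a * b * (a * b + c * d)) : ℤ) * this⟩
  have h3 := ht.dvd_card a
  rw [Finset.card_filter] at h3
  simp only [Fin.sum_univ_succ] at h3
  simp [Ne.symm hne.1, Ne.symm hne.2] at h3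
  by_cases hb' : b = a <;> simp [hb'] at h3

/-! ### Edge bounds for rectangle-free bipartite graphs -/

section Rectangle

variable {α β : Type*}

/-- The left side counts ordered pairs of edges with a common left endpoint. Equal right endpoints
give |E| pairs; two distinct right endpoints determine their common neighbour, giving at most |V|^2.
-/
theorem sum_sq_degree_le [DecidableEq α] [DecidableEq β] (E : Finset (α × β)) (U : Finset α)
    (V : Finset β) (hE : E ⊆ U ×ˢ V)
    (hrect : ∀ u₁ u₂ v₁ v₂, (u₁, v₁) ∈ E → (u₁, v₂) ∈ E → (u₂, v₁) ∈ E → (u₂, v₂) ∈ E →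
      u₁ = u₂ ∨ v₁ = v₂) :
    ∑ u ∈ U, (E.filter fun e => e.1 = u).card ^ 2 ≤ E.card + V.card ^ 2 := by
  have h1 : ∑ u ∈ U, (E.filter fun e => e.1 = u).card ^ 2
      = ((E ×ˢ E).filter fun e => e.1.1 = e.2.1).card := by
    rw [Finset.card_eq_sum_card_fiberwise (f := fun e => e.1.1) (t := U)]
    · refine Finset.sum_congr rfl fun u _ => ?_
      rw [sq, ← Finset.card_product]
      congr 1
      ext ⟨⟨a, b⟩, ⟨c, d⟩⟩
      simp only [Finset.mem_product, Finset.mem_filter]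
      constructor
      · rintro ⟨⟨h1, rfl⟩, h2, rfl⟩; exact ⟨⟨⟨h1, h2⟩, rfl⟩, rfl⟩
      · rintro ⟨⟨⟨h1, h2⟩, rfl⟩, rfl⟩; exact ⟨⟨h1, rfl⟩, h2, rfl⟩
    · intro e he
      simp only [Finset.coe_filter, Finset.mem_product, Set.mem_ofPred_eq] at he
      exact (Finset.mem_product.1 (hE he.1.1)).1
  rw [h1, ← Finset.card_filter_add_card_filter_not (p := fun e : (α × β) × (α × β) => e.1.2 = e.2.2)]
  refine Nat.add_le_add ?_ ?_
  · refine Finset.card_le_card_of_injOn Prod.fst ?_ ?_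
    · intro e he
      simp only [Finset.coe_filter, Finset.mem_filter, Finset.mem_product, Set.mem_ofPred_eq] at he
      exact he.1.1.1
    · rintro ⟨⟨a, b⟩, ⟨c, d⟩⟩ he ⟨⟨a', b'⟩, ⟨c', d'⟩⟩ he' h
      simp only [Finset.coe_filter, Finset.mem_filter, Finset.mem_product, Set.mem_ofPred_eq]
        at he he' h
      grind
  · rw [sq, ← Finset.card_product]
    refine Finset.card_le_card_of_injOn (fun e => (e.1.2, e.2.2)) ?_ ?_
    · intro e he
      simp only [Finset.coe_filter, Finset.mem_filter, Finset.mem_product, Set.mem_ofPred_eq] at he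
      have := hE he.1.1.1
      have := hE he.1.1.2
      simp_all
    · rintro ⟨⟨a, b⟩, ⟨c, d⟩⟩ he ⟨⟨a', b'⟩, ⟨c', d'⟩⟩ he' h
      simp only [Finset.coe_filter, Finset.mem_filter, Finset.mem_product, Set.mem_ofPred_eq,
        Prod.mk.injEq] at he he' h
      obtain ⟨⟨⟨h1, h2⟩, rfl⟩, h3⟩ := he
      obtain ⟨⟨⟨h1', h2'⟩, rfl⟩, h3'⟩ := he'
      obtain ⟨rfl, rfl⟩ := h
      rcases hrect _ _ _ _ h1 h2 h1' h2' with h | h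
      · subst h; rfl
      · exact absurd h h3

theorem card_eq_sum_degree [DecidableEq α] (E : Finset (α × β)) (U : Finset α)
    (V : Finset β) (hE : E ⊆ U ×ˢ V) :
    ∑ u ∈ U, (E.filter fun e => e.1 = u).card = E.card := by
  rw [Finset.card_eq_sum_card_fiberwise (f := Prod.fst) (t := U)]
  intro e he
  exact (Finset.mem_product.1 (hE he)).1

/-- Summing 2d ≤ d^2 + 1 over the degrees keeps coefficient 1 on |U|, which the exact main term π(n)
requires. -/
theorem card_le_add_sq_of_rectangle_free (E : Finset (α × β)) (U : Finset α)
    (V : Finset β) (hE : E ⊆ U ×ˢ V)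
    (hrect : ∀ u₁ u₂ v₁ v₂, (u₁, v₁) ∈ E → (u₁, v₂) ∈ E → (u₂, v₁) ∈ E → (u₂, v₂) ∈ E →
      u₁ = u₂ ∨ v₁ = v₂) :
    E.card ≤ U.card + V.card ^ 2 := by
  classical
  have h1 := sum_sq_degree_le E U V hE hrect
  have h2 := card_eq_sum_degree E U V hE
  have h3 : ∑ u ∈ U, 2 * (E.filter fun e => e.1 = u).card
      ≤ ∑ u ∈ U, ((E.filter fun e => e.1 = u).card ^ 2 + 1) :=
    Finset.sum_le_sum fun u _ => by
      simpa using two_mul_le_add_sq (E.filter fun e => e.1 = u).card 1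
  rw [← Finset.mul_sum, Finset.sum_add_distrib, h2] at h3
  simp at h3
  omega

theorem card_le_add_mul_sqrt_of_rectangle_free (E : Finset (α × β)) (U : Finset α)
    (V : Finset β) (hE : E ⊆ U ×ˢ V)
    (hrect : ∀ u₁ u₂ v₁ v₂, (u₁, v₁) ∈ E → (u₁, v₂) ∈ E → (u₂, v₁) ∈ E → (u₂, v₂) ∈ E →
      u₁ = u₂ ∨ v₁ = v₂) :
    (E.card : ℝ) ≤ U.card + V.card * √U.card := by
  classical
  have h1 := sum_sq_degree_le E U V hE hrect
  have h2 := card_eq_sum_degree E U V hE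
  have h3 := sq_sum_le_card_mul_sum_sq (s := U) (f := fun u => (E.filter fun e => e.1 = u).card)
  rw [h2] at h3
  have h4 : (E.card : ℝ) ^ 2 ≤ U.card * (E.card + V.card ^ 2) := by
    exact_mod_cast h3.trans (Nat.mul_le_mul_left _ h1)
  have h5 : √(U.card : ℝ) ^ 2 = U.card := Real.sq_sqrt (by positivity)
  set r := √(U.card : ℝ)
  have hr : 0 ≤ r := Real.sqrt_nonneg _
  rw [← h5] at h4 ⊢
  by_contra! hlt
  have hV : (0 : ℝ) ≤ V.card := by positivity
  have hvr : 0 ≤ V.card * r := by positivity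
  -- If |E| > r^2 + |V|r, both factors on the right exceed |V|r, against the Cauchy-Schwarz bound
  -- |E|^2 ≤ r^2(|E| + |V|^2).
  have h6 : (V.card * r) * (V.card * r) < E.card * (E.card - r ^ 2) := by
    apply mul_lt_mul'' <;> nlinarith
  nlinarith

end Rectangle

/-- One factorization is chosen per member. A rectangle gives (u₁v₁)(u₂v₂) = (u₁v₂)(u₂v₁), which the
Sidon property makes degenerate. -/
theorem MulSidon.exists_rectangle_free {A : Set ℕ} (hA : MulSidon A) (hpos : ∀ a ∈ A, 0 < a)
    {B U V : Finset ℕ} (hB : (B : Set ℕ) ⊆ A)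
    (h : ∀ a ∈ B, ∃ u ∈ U, ∃ v ∈ V, a = u * v) :
    ∃ E : Finset (ℕ × ℕ), E ⊆ U ×ˢ V ∧ E.card = B.card ∧
      ∀ u₁ u₂ v₁ v₂, (u₁, v₁) ∈ E → (u₁, v₂) ∈ E → (u₂, v₁) ∈ E → (u₂, v₂) ∈ E →
        u₁ = u₂ ∨ v₁ = v₂ := by
  classical
  choose! u hu v hv huv using h
  refine ⟨B.image fun a => (u a, v a), ?_, ?_, ?_⟩
  · intro e he
    obtain ⟨a, ha, rfl⟩ := Finset.mem_image.1 he
    exact Finset.mk_mem_product (hu a ha) (hv a ha)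
  · refine Finset.card_image_of_injOn fun a ha b hb hab => ?_
    simp only [Prod.mk.injEq] at hab
    rw [huv a ha, huv b hb, hab.1, hab.2]
  · have key : ∀ x y, (x, y) ∈ B.image (fun a => (u a, v a)) → x * y ∈ A := by
      intro x y hxy
      obtain ⟨a, ha, h⟩ := Finset.mem_image.1 hxy
      simp only [Prod.mk.injEq] at h
      rw [← h.1, ← h.2, ← huv a ha]
      exact hB ha
    intro u₁ u₂ v₁ v₂ h11 h12 h21 h22
    have p11 := hpos _ (key _ _ h11)
    rcases hA _ (key _ _ h11) _ (key _ _ h22) _ (key _ _ h12) _ (key _ _ h21) (by ring) with h | h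
    · exact Or.inr (Nat.eq_of_mul_eq_mul_left (Nat.pos_of_mul_pos_right p11) h)
    · exact Or.inl (Nat.eq_of_mul_eq_mul_right (Nat.pos_of_mul_pos_left p11) h)

theorem MulSidon.card_le_add_sq {A : Set ℕ} (hA : MulSidon A) (hpos : ∀ a ∈ A, 0 < a)
    {B U V : Finset ℕ} (hB : (B : Set ℕ) ⊆ A)
    (h : ∀ a ∈ B, ∃ u ∈ U, ∃ v ∈ V, a = u * v) : B.card ≤ U.card + V.card ^ 2 := by
  obtain ⟨E, hE, hc, hr⟩ := hA.exists_rectangle_free hpos hB h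
  rw [← hc]
  exact card_le_add_sq_of_rectangle_free E U V hE hr

theorem MulSidon.card_le_add_mul_sqrt {A : Set ℕ} (hA : MulSidon A) (hpos : ∀ a ∈ A, 0 < a)
    {B U V : Finset ℕ} (hB : (B : Set ℕ) ⊆ A)
    (h : ∀ a ∈ B, ∃ u ∈ U, ∃ v ∈ V, a = u * v) :
    (B.card : ℝ) ≤ U.card + V.card * √U.card := by
  obtain ⟨E, hE, hc, hr⟩ := hA.exists_rectangle_free hpos hB h
  rw [← hc]
  exact card_le_add_mul_sqrt_of_rectangle_free E U V hE hr

/-! ### Chebyshev and Mertens estimates; counting rough blocks -/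

open Finset in
-- Mertens's argument: the logarithms of the radicals of k ≤ n sum to at most n log n. Exchanging
-- summation gives ⌊n/p⌋ log p, and removing the floors costs θ(n) ≤ n log 4.
theorem sum_log_div_prime_le {n : ℕ} (hn : 0 < n) :
    ∑ p ∈ Nat.primesLE n, Real.log p / p ≤ Real.log n + Real.log 4 := by
  have hn' : (0 : ℝ) < n := by exact_mod_cast hn
  have h1 : ∑ k ∈ Ioc 0 n, ∑ p ∈ k.primeFactors, Real.log p ≤ n * Real.log n := by
    calc ∑ k ∈ Ioc 0 n, ∑ p ∈ k.primeFactors, Real.log p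
        ≤ ∑ k ∈ Ioc 0 n, Real.log n := by
          refine sum_le_sum fun k hk => ?_
          rw [mem_Ioc] at hk
          rw [← Real.log_prod fun p hp => by
            exact_mod_cast (Nat.prime_of_mem_primeFactors hp).ne_zero]
          refine Real.log_le_log ?_ ?_
          · exact prod_pos fun p hp => by exact_mod_cast (Nat.prime_of_mem_primeFactors hp).pos
          · rw [← Nat.cast_prod]
            exact_mod_cast (Nat.le_of_dvd hk.1 (Nat.prod_primeFactors_dvd k)).trans hk.2
      _ = n * Real.log n := by simp
  have h2 : ∑ k ∈ Ioc 0 n, ∑ p ∈ k.primeFactors, Real.log p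
      = ∑ p ∈ Nat.primesLE n, ((n / p : ℕ) : ℝ) * Real.log p := by
    rw [sum_comm' (t' := Nat.primesLE n) (s' := fun p => (Ioc 0 n).filter (p ∣ ·))]
    · refine sum_congr rfl fun p _ => ?_
      rw [sum_const, Nat.Ioc_filter_dvd_card_eq_div, nsmul_eq_mul]
    · intro k p
      simp only [mem_Ioc, Nat.mem_primeFactors, mem_filter, Nat.mem_primesLE]
      constructor
      · rintro ⟨⟨h1, h2⟩, hp, hd, h0⟩
        exact ⟨⟨⟨h1, h2⟩, hd⟩, (Nat.le_of_dvd h1 hd).trans h2, hp⟩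
      · rintro ⟨⟨⟨h1, h2⟩, hd⟩, h3, hp⟩
        exact ⟨⟨h1, h2⟩, hp, hd, h1.ne'⟩
  have h3 : n * ∑ p ∈ Nat.primesLE n, Real.log p / p
      ≤ ∑ p ∈ Nat.primesLE n, (((n / p : ℕ) : ℝ) * Real.log p + Real.log p) := by
    rw [mul_sum]
    refine sum_le_sum fun p hp => ?_
    have hp0 : (0 : ℝ) < p := by exact_mod_cast (Nat.prime_of_mem_primesLE hp).pos
    have hlog : 0 ≤ Real.log p := Real.log_natCast_nonneg p
    have : (n : ℝ) / p ≤ (n / p : ℕ) + 1 := by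
      rw [← Nat.floor_div_eq_div (K := ℝ) n p]; exact (Nat.lt_floor_add_one _).le
    calc (n : ℝ) * (Real.log p / p) = (n / p) * Real.log p := by ring
      _ ≤ ((n / p : ℕ) + 1) * Real.log p := by gcongr
      _ = _ := by ring
  have h4 := Chebyshev.theta_le_log4_mul_x hn'.le
  rw [Chebyshev.theta_eq_sum_primesLE_log] at h4
  rw [sum_add_distrib, ← h2] at h3
  have h5 : n * ∑ p ∈ Nat.primesLE n, Real.log p / p ≤ n * (Real.log n + Real.log 4) := by
    linarith
  exact le_of_mul_le_mul_left h5 hn'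

theorem card_rough_primes_le {z x : ℝ} (hz : 1 < z) (hx : 0 ≤ x) :
    (((Nat.primesLE ⌊x⌋₊).filter fun p : ℕ => z < p).card : ℝ) ≤ Real.log 4 * x / Real.log z := by
  rw [le_div_iff₀ (Real.log_pos hz), ← nsmul_eq_mul]
  calc _ ≤ ∑ p ∈ (Nat.primesLE ⌊x⌋₊).filter fun p : ℕ => z < p, Real.log p := by
        refine Finset.card_nsmul_le_sum _ _ _ fun p hp => ?_
        exact Real.log_le_log (by linarith) (Finset.mem_filter.1 hp).2.le
    _ ≤ ∑ p ∈ Nat.primesLE ⌊x⌋₊, Real.log p :=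
        Finset.sum_le_sum_of_subset_of_nonneg (Finset.filter_subset _ _)
          fun p _ _ => Real.log_natCast_nonneg p
    _ ≤ _ := by
        rw [← Chebyshev.theta_eq_sum_primesLE]; exact Chebyshev.theta_le_log4_mul_x hx

/-- Products of one or two primes, all exceeding `z`. -/
def IsRoughBlock (z : ℝ) (s : ℕ) : Prop :=
  (s.Prime ∧ z < s) ∨ ∃ p q : ℕ, p.Prime ∧ q.Prime ∧ z < p ∧ z < q ∧ s = p * q

theorem IsRoughBlock.pos {z : ℝ} {s : ℕ} (h : IsRoughBlock z s) : 0 < s := by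
  rcases h with h | ⟨p, q, hp, hq, -, -, rfl⟩
  · exact h.1.pos
  · exact Nat.mul_pos hp.pos hq.pos

open Classical in
/-- The rough blocks not exceeding `x`. -/
noncomputable def roughBlocks (z x : ℝ) : Finset ℕ :=
  (Finset.Icc 1 ⌊x⌋₊).filter (IsRoughBlock z)

theorem mem_roughBlocks {z x : ℝ} {s : ℕ} (hx : 0 ≤ x) :
    s ∈ roughBlocks z x ↔ (s : ℝ) ≤ x ∧ IsRoughBlock z s := by
  simp only [roughBlocks, Finset.mem_filter, Finset.mem_Icc]
  constructor
  · rintro ⟨⟨-, h⟩, h'⟩; exact ⟨(Nat.le_floor_iff hx).1 h, h'⟩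
  · rintro ⟨h, h'⟩; exact ⟨⟨h'.pos, Nat.le_floor h⟩, h'⟩

/-- For fixed p the q ≤ x/p number O(x/(p log z)), and the sum of 1/p over z < p ≤ n is at most (log
n + log 4)/log z. For z a fixed power of n this is bounded, so products of two primes are no denser
in order than primes. -/
theorem card_roughBlocks_le {z x : ℝ} {n : ℕ} (hn : 0 < n) (hz : 1 < z) (hx : 0 ≤ x)
    (hxn : x ≤ n) :
    ((roughBlocks z x).card : ℝ)
      ≤ Real.log 4 * x / Real.log z * (1 + (Real.log n + Real.log 4) / Real.log z) := by
  classical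
  have hlz := Real.log_pos hz
  set P := (Nat.primesLE ⌊x⌋₊).filter fun p : ℕ => z < p with hP
  have hsub : roughBlocks z x ⊆ P ∪
      ((Nat.primesLE n).filter fun p : ℕ => z < p).biUnion fun p =>
        ((Nat.primesLE ⌊x / p⌋₊).filter fun q : ℕ => z < q).image (p * ·) := by
    intro s hs
    obtain ⟨hsx, ⟨h1, h2⟩ | ⟨p, q, hp, hq, hpz, hqz, rfl⟩⟩ := (mem_roughBlocks hx).1 hs
    · exact Finset.mem_union_left _
        (Finset.mem_filter.2 ⟨Nat.mem_primesLE.2 ⟨Nat.le_floor hsx, h1⟩, h2⟩)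
    · refine Finset.mem_union_right _ (Finset.mem_biUnion.2 ⟨p, ?_, ?_⟩)
      · refine Finset.mem_filter.2 ⟨Nat.mem_primesLE.2 ⟨?_, hp⟩, hpz⟩
        have : ((p * q : ℕ) : ℝ) ≤ n := hsx.trans hxn
        exact (Nat.le_mul_of_pos_right p hq.pos).trans (by exact_mod_cast this)
      · refine Finset.mem_image.2 ⟨q, Finset.mem_filter.2
          ⟨Nat.mem_primesLE.2 ⟨Nat.le_floor ?_, hq⟩, hqz⟩, rfl⟩
        rw [le_div_iff₀ (by exact_mod_cast hp.pos)]
        push_cast at hsx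
        linarith
  have h1 : (P.card : ℝ) ≤ Real.log 4 * x / Real.log z := card_rough_primes_le hz hx
  have h2 : ∑ p ∈ (Nat.primesLE n).filter fun p : ℕ => z < p, (1 / p : ℝ)
      ≤ (Real.log n + Real.log 4) / Real.log z := by
    rw [le_div_iff₀ hlz, Finset.sum_mul]
    refine le_trans ?_ (sum_log_div_prime_le hn)
    refine le_trans (Finset.sum_le_sum (g := fun p : ℕ => Real.log p / p) fun p hp => ?_)
      (Finset.sum_le_sum_of_subset_of_nonneg (Finset.filter_subset _ _) fun p _ _ => ?_)
    · rw [one_div_mul_eq_div]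
      have := Real.log_le_log (by linarith) (Finset.mem_filter.1 hp).2.le
      gcongr
    · exact div_nonneg (Real.log_natCast_nonneg p) (Nat.cast_nonneg p)
  calc ((roughBlocks z x).card : ℝ)
      ≤ P.card + ∑ p ∈ (Nat.primesLE n).filter fun p : ℕ => z < p,
          (((Nat.primesLE ⌊x / p⌋₊).filter fun q : ℕ => z < q).card : ℝ) := by
        have h := (Finset.card_le_card hsub).trans (Finset.card_union_le _ _)
        have h' := h.trans (Nat.add_le_add_left (Finset.card_biUnion_le.trans
          (Finset.sum_le_sum fun p _ => Finset.card_image_le)) _)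
        exact_mod_cast h'
    _ ≤ Real.log 4 * x / Real.log z + ∑ p ∈ (Nat.primesLE n).filter fun p : ℕ => z < p,
          Real.log 4 * x / Real.log z * (1 / p : ℝ) := by
        gcongr with p hp
        refine (card_rough_primes_le hz (by positivity)).trans (le_of_eq ?_)
        ring
    _ = Real.log 4 * x / Real.log z * (1 + ∑ p ∈ (Nat.primesLE n).filter fun p : ℕ => z < p,
          (1 / p : ℝ)) := by rw [← Finset.mul_sum]; ring
    _ ≤ _ := by
        have : 0 ≤ Real.log 4 := Real.log_nonneg (by norm_num)
        gcongr

/-! ### Factoring integers with a gap among their divisors -/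

/-- If no divisor of `a` lies in `[L, H]`, then multiplying a divisor below `L` by primes not
exceeding `H / L` never leads out of the range below `L`. -/
theorem lt_of_smooth_multiple {a : ℕ} {L H : ℝ} (hL : 0 < L)
    (hgap : ∀ d : ℕ, d ∣ a → (d : ℝ) < L ∨ H < d) :
    ∀ (l : List ℕ) (d : ℕ), (∀ p ∈ l, (p : ℝ) ≤ H / L) → d * l.prod ∣ a → (d : ℝ) < L →
      ((d * l.prod : ℕ) : ℝ) < L := by
  intro l
  induction l with
  | nil => intro d _ _ h; simpa using h
  | cons p l ih =>
    intro d hl hd h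
    rw [List.prod_cons, ← mul_assoc] at hd ⊢
    refine ih (d * p) (fun q hq => hl q (List.mem_cons_of_mem _ hq)) hd ?_
    rcases hgap (d * p) ((Dvd.intro _ rfl).trans hd) with h' | h'
    · exact h'
    · exfalso
      have hp : (p : ℝ) ≤ H / L := hl p List.mem_cons_self
      rw [le_div_iff₀ hL] at hp
      push_cast at h'
      have : (0 : ℝ) ≤ p := Nat.cast_nonneg p
      nlinarith

/-- Decomposition of an integer none of whose divisors lies in `[L, H]`. -/
theorem exists_rough_blocks_of_gap {a : ℕ} {L H T z : ℝ} (ha : 0 < a) (hL : 1 < L)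
    (hz : z ≤ H / L) (hLH : L ^ 3 ≤ H ^ 2) (haL : L ^ 3 < a) (hT : (a : ℝ) = T * L)
    (hprime : ∀ p : ℕ, p.Prime → p ∣ a → (p : ℝ) ≤ T)
    (hgap : ∀ d : ℕ, d ∣ a → (d : ℝ) < L ∨ H < d) (hH : 0 < H) :
    ∃ s t : ℕ, IsRoughBlock z s ∧ IsRoughBlock z t ∧ H < s ∧ H < t ∧ s * t ∣ a := by
  have hL0 : 0 < L := by linarith
  set l := a.primeFactorsList with hl
  set small := l.filter fun p : ℕ => (p : ℝ) ≤ H / L with hsmall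
  set big := l.filter fun p : ℕ => ¬ (p : ℝ) ≤ H / L with hbig
  have hab : a = small.prod * big.prod := by
    have h := List.prod_map_filter_mul_prod_map_filter_not (fun p : ℕ => (p : ℝ) ≤ H / L) id l
    simp only [List.map_id] at h
    rw [hsmall, hbig, h, hl, Nat.prod_primeFactorsList ha.ne']
  have hsm : ∀ p ∈ small, (p : ℝ) ≤ H / L := by
    intro p hp
    simpa using (List.mem_filter.1 hp).2
  have hbg : ∀ p ∈ big, p.Prime ∧ p ∣ a ∧ H / L < p := by
    intro p hp
    rw [hbig, List.mem_filter] at hp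
    exact ⟨Nat.prime_of_mem_primeFactorsList hp.1, Nat.dvd_of_mem_primeFactorsList hp.1,
      by simpa using hp.2⟩
  have hsub : ∀ d : ℕ, d ∣ big.prod → (d : ℝ) < L → ((d * small.prod : ℕ) : ℝ) < L := by
    intro d hd h
    refine lt_of_smooth_multiple hL0 hgap small d hsm ?_ h
    rw [hab, mul_comm]
    exact Nat.mul_dvd_mul_left _ hd
  have hbd : big.prod ∣ a := ⟨_, hab.trans (mul_comm _ _)⟩
  -- Since L^3 ≤ H^2, the product of two large primes exceeds (H/L)^2 ≥ L, so it lies beyond the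
  -- gap.
  have hpair : ∀ p q : ℕ, H / L < p → H / L < q → p * q ∣ big.prod → H < (p * q : ℕ) := by
    intro p q hp hq hd
    refine (hgap _ (hd.trans hbd)).resolve_left ?_
    push_cast
    have h1 : H / L * (H / L) < p * q := by
      have : 0 < H / L := by positivity
      apply mul_lt_mul'' hp hq <;> positivity
    have h2 : L ≤ H / L * (H / L) := by
      rw [div_mul_div_comm, le_div_iff₀ (by positivity)]
      nlinarith
    linarith
  have hm : (small.prod : ℝ) < L := by simpa using hsub 1 (one_dvd _) (by simpa using hL)
  -- The cofactor of p would be below L and p is at most T, so the product would be below TL = a.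
  have hmul : ∀ p d : ℕ, p.Prime → p ∣ a → (d : ℝ) < L → d ∣ big.prod → a ≠ small.prod * (p * d) := by
    intro p d hp hpa hd hdb h
    have h1 := hsub d hdb hd
    have h2 := hprime p hp hpa
    have h3 : (a : ℝ) = p * (d * small.prod : ℕ) := by rw [h]; push_cast; ring
    have hp0 : (0 : ℝ) < p := by exact_mod_cast hp.pos
    nlinarith
  have hL3 : L ≤ L ^ 3 := le_self_pow₀ hL.le (by norm_num)
  have blk1 : ∀ p, p ∈ big → IsRoughBlock z p := fun p hp =>
    Or.inl ⟨(hbg p hp).1, hz.trans_lt (hbg p hp).2.2⟩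
  have blk2 : ∀ p q, p ∈ big → q ∈ big → IsRoughBlock z (p * q) := fun p q hp hq =>
    Or.inr ⟨p, q, (hbg p hp).1, (hbg q hq).1, hz.trans_lt (hbg p hp).2.2, hz.trans_lt (hbg q hq).2.2, rfl⟩
  have hdich : ∀ p, p ∈ big → (p : ℝ) < L ∨ H < p := fun p hp => hgap p (hbg p hp).2.1
  have e11 : ∀ p q, p ∈ big → q ∈ big → p * q ∣ big.prod → H < p → H < q →
      ∃ s t : ℕ, IsRoughBlock z s ∧ IsRoughBlock z t ∧ H < s ∧ H < t ∧ s * t ∣ a :=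
    fun p q hp hq hd h1 h2 => ⟨p, q, blk1 p hp, blk1 q hq, h1, h2, hd.trans hbd⟩
  have e12 : ∀ p q r, p ∈ big → q ∈ big → r ∈ big → p * (q * r) ∣ big.prod → H < p →
      ∃ s t : ℕ, IsRoughBlock z s ∧ IsRoughBlock z t ∧ H < s ∧ H < t ∧ s * t ∣ a :=
    fun p q r hp hq hr hd h1 => ⟨p, q * r, blk1 p hp, blk2 q r hq hr, h1,
      hpair q r (hbg q hq).2.2 (hbg r hr).2.2 ((Dvd.intro_left _ rfl).trans hd), hd.trans hbd⟩
  have e22 : ∀ p q r w, p ∈ big → q ∈ big → r ∈ big → w ∈ big → p * q * (r * w) ∣ big.prod →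
      ∃ s t : ℕ, IsRoughBlock z s ∧ IsRoughBlock z t ∧ H < s ∧ H < t ∧ s * t ∣ a :=
    fun p q r w hp hq hr hw hd => ⟨p * q, r * w, blk2 p q hp hq, blk2 r w hr hw,
      hpair p q (hbg p hp).2.2 (hbg q hq).2.2 ((Dvd.intro _ rfl).trans hd),
      hpair r w (hbg r hr).2.2 (hbg w hw).2.2 ((Dvd.intro_left _ rfl).trans hd), hd.trans hbd⟩
  clear_value big small
  clear hbig
  generalize hN : big.prod = N at *
  -- The split is on the number of large primes. Four or more pair off into two blocks. With three,
  -- one exceeds H and the other two form a block, since otherwise a < L^3. With two, both must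
  -- exceed H; fewer are impossible.
  rcases big with _ | ⟨p, _ | ⟨q, _ | ⟨r, _ | ⟨w, rest⟩⟩⟩⟩
  · exfalso
    rw [← hN, List.prod_nil, mul_one] at hab
    rw [← hab] at hm
    linarith
  · exfalso
    have hp : p ∈ [p] := by simp
    simp only [List.prod_cons, List.prod_nil, mul_one] at hN
    subst hN
    rcases hdich p hp with h | h
    · have := hsub p dvd_rfl h
      rw [mul_comm, ← hab] at this
      linarith
    · exact hmul p 1 (hbg p hp).1 (hbg p hp).2.1 (by simpa using hL) (one_dvd _) (by simpa using hab)
  · have hp : p ∈ [p, q] := by simp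
    have hq : q ∈ [p, q] := by simp
    simp only [List.prod_cons, List.prod_nil, mul_one] at hN
    subst hN
    rcases hdich p hp with h | h <;> rcases hdich q hq with h' | h'
    · exfalso
      have h1 := hsub p (Dvd.intro _ rfl) h
      have h2 : (a : ℝ) = (p * small.prod : ℕ) * q := by rw [hab]; push_cast; ring
      have : (a : ℝ) ≤ L * L := by
        rw [h2]; gcongr
      nlinarith
    · exact absurd (by rw [mul_comm q p]; exact hab)
        (hmul q p (hbg q hq).1 (hbg q hq).2.1 h (Dvd.intro _ rfl))
    · exact absurd hab (hmul p q (hbg p hp).1 (hbg p hp).2.1 h' (Dvd.intro_left _ rfl))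
    · exact e11 p q hp hq dvd_rfl h h'
  · have hp : p ∈ [p, q, r] := by simp
    have hq : q ∈ [p, q, r] := by simp
    have hr : r ∈ [p, q, r] := by simp
    simp only [List.prod_cons, List.prod_nil, mul_one] at hN
    subst hN
    rcases hdich p hp with h | h
    · rcases hdich q hq with h' | h'
      · rcases hdich r hr with h'' | h''
        · exfalso
          have h1 := hsub p (Dvd.intro _ rfl) h
          have h2 : (a : ℝ) = (p * small.prod : ℕ) * q * r := by rw [hab]; push_cast; ring
          have : (a : ℝ) ≤ L * L * L := by
            rw [h2]; gcongr
          nlinarith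
        · exact e12 r p q hr hp hq (dvd_of_eq (by ring)) h''
      · exact e12 q p r hq hp hr (dvd_of_eq (by ring)) h'
    · exact e12 p q r hp hq hr dvd_rfl h
  · exact e22 p q r w (by simp) (by simp) (by simp) (by simp) ⟨rest.prod, by rw [← hN]; simp; ring⟩

theorem card_Icc_floor_le {x : ℝ} (hx : 0 ≤ x) : ((Finset.Icc 1 ⌊x⌋₊).card : ℝ) ≤ x := by
  simpa using Nat.floor_le hx

theorem rough_trichotomy {w : ℝ} (hw : 1 < w) {a : ℕ} (ha : 0 < a) (haw : (a : ℝ) ≤ w ^ 80) :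
    (∃ p : ℕ, p.Prime ∧ p ∣ a ∧ w ^ 56 < p) ∨
    (∃ u v : ℕ, a = u * v ∧ (u : ℝ) ≤ w ^ 56 ∧ (v : ℝ) ≤ w ^ 36) ∨
    (∃ m s t : ℕ, a = m * s * t ∧ IsRoughBlock (w ^ 12) s ∧ IsRoughBlock (w ^ 12) t ∧
      w ^ 36 < t ∧ t ≤ s) := by
  by_contra! hcon
  obtain ⟨h1, h2, h3⟩ := hcon
  have hw0 : 0 < w := by linarith
  have ha0 : (0 : ℝ) < a := by exact_mod_cast ha
  have hpow : ∀ {i j : ℕ}, i ≤ j → w ^ i ≤ w ^ j := fun h => pow_le_pow_right₀ hw.le h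
  have hL : 1 < a / w ^ 56 := by
    rw [lt_div_iff₀ (by positivity), one_mul]
    by_contra! h
    have := h2 a 1 (by simp) h
    have := one_lt_pow₀ hw (n := 36) (by norm_num)
    norm_num at *
    linarith
  have hL24 : a / w ^ 56 ≤ w ^ 24 := by
    rw [div_le_iff₀ (by positivity), ← pow_add]
    exact haw
  have hL0 : 0 < a / w ^ 56 := by linarith
  -- Without a balanced factorization no divisor lies in [a/w^56, w^36]. As L = a/w^56 ≤ w^24, both
  -- H/L ≥ w^12 and L^3 ≤ w^72 = H^2 follow.
  obtain ⟨s, t, hs, ht, hsH, htH, hd⟩ := exists_rough_blocks_of_gap (a := a) (L := a / w ^ 56)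
    (H := w ^ 36) (T := w ^ 56) (z := w ^ 12) ha hL
    (by
      rw [le_div_iff₀ hL0]
      calc w ^ 12 * (a / w ^ 56) ≤ w ^ 12 * w ^ 24 := by gcongr
        _ = w ^ 36 := by ring)
    (by
      calc (a / w ^ 56) ^ 3 ≤ (w ^ 24) ^ 3 := by gcongr
        _ = (w ^ 36) ^ 2 := by ring)
    (by
      rw [div_pow, div_lt_iff₀ (by positivity)]
      have h5 : (a : ℝ) ^ 2 < (w ^ 56) ^ 3 := by
        calc (a : ℝ) ^ 2 ≤ (w ^ 80) ^ 2 := by gcongr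
          _ < (w ^ 56) ^ 3 := by
            rw [← pow_mul, ← pow_mul]
            exact pow_lt_pow_right₀ hw (by norm_num)
      nlinarith)
    (by field_simp)
    (fun p hp hpa => h1 p hp hpa)
    (fun d hda => by
      by_contra! h
      have hd0 : (0 : ℝ) < d := by linarith
      have := h2 (a / d) d (Nat.div_mul_cancel hda).symm (by
        rw [Nat.cast_div hda hd0.ne', div_le_iff₀ hd0]
        have := h.1
        rw [div_le_iff₀ (by positivity)] at this
        linarith)
      linarith [h.2])
    (by positivity)
  obtain ⟨m, hm⟩ := hd
  rcases le_total t s with h | h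
  · have := h3 m s t (by rw [hm]; ring) hs ht htH
    omega
  · have := h3 m t s (by rw [hm]; ring) ht hs hsH
    omega

/-! ### Bounds for the first two classes of a Sidon set -/

open Classical in
theorem MulSidon.card_large_prime_le {A : Finset ℕ} (hA : MulSidon (A : Set ℕ)) {n : ℕ} {w : ℝ}
    (hw : 1 < w) (hwn : w ^ 80 = n) (hAn : A ⊆ Finset.Icc 1 n) :
    ((A.filter fun a => ∃ p : ℕ, p.Prime ∧ p ∣ a ∧ w ^ 56 < p).card : ℝ)
      ≤ Nat.primeCounting n + w ^ 48 := by
  have hw0 : 0 < w := by linarith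
  have hpos : ∀ a ∈ (A : Set ℕ), 0 < a := fun a ha => (Finset.mem_Icc.1 (hAn ha)).1
  have h := hA.card_le_add_sq hpos (B := A.filter fun a => ∃ p : ℕ, p.Prime ∧ p ∣ a ∧ w ^ 56 < p)
    (U := Nat.primesLE n) (V := Finset.Icc 1 ⌊w ^ 24⌋₊)
    (by exact_mod_cast Finset.filter_subset _ _)
    (by
      intro a ha
      obtain ⟨haA, p, hp, ⟨v, rfl⟩, hpw⟩ := Finset.mem_filter.1 ha
      have hn := (Finset.mem_Icc.1 (hAn haA)).2
      have h0 := hpos _ haA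
      have hv0 : 0 < v := Nat.pos_of_mul_pos_left h0
      refine ⟨p, Nat.mem_primesLE.2 ⟨(Nat.le_mul_of_pos_right p hv0).trans hn, hp⟩, v,
        Finset.mem_Icc.2 ⟨hv0, Nat.le_floor ?_⟩, rfl⟩
      have h1 : (p : ℝ) * v ≤ w ^ 56 * w ^ 24 := by
        rw [← pow_add, hwn]; exact_mod_cast hn
      have h2 : (0 : ℝ) < v := by exact_mod_cast hv0
      by_contra! h3
      have : w ^ 56 * w ^ 24 < p * v := by apply mul_lt_mul'' hpw h3 <;> positivity
      linarith)
  have h' : ((A.filter fun a => ∃ p : ℕ, p.Prime ∧ p ∣ a ∧ w ^ 56 < p).card : ℝ)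
      ≤ (Nat.primesLE n).card + ((Finset.Icc 1 ⌊w ^ 24⌋₊).card : ℝ) ^ 2 := by exact_mod_cast h
  rw [Nat.primesLE_card_eq_primeCounting] at h'
  have h2 := card_Icc_floor_le (x := w ^ 24) (by positivity)
  calc _ ≤ _ := h'
    _ ≤ Nat.primeCounting n + (w ^ 24) ^ 2 := by gcongr
    _ = _ := by ring

open Classical in
theorem MulSidon.card_factorable_le {A : Finset ℕ} (hA : MulSidon (A : Set ℕ))
    (hpos : ∀ a ∈ A, 0 < a) {x y : ℝ} (hx : 0 ≤ x) (hy : 0 ≤ y) :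
    ((A.filter fun a => ∃ u v : ℕ, a = u * v ∧ (u : ℝ) ≤ x ∧ (v : ℝ) ≤ y).card : ℝ)
      ≤ x + y * √x := by
  have h := hA.card_le_add_mul_sqrt (by exact_mod_cast hpos)
    (B := A.filter fun a => ∃ u v : ℕ, a = u * v ∧ (u : ℝ) ≤ x ∧ (v : ℝ) ≤ y)
    (U := Finset.Icc 1 ⌊x⌋₊) (V := Finset.Icc 1 ⌊y⌋₊)
    (by exact_mod_cast Finset.filter_subset _ _)
    (by
      intro a ha
      obtain ⟨haA, u, v, rfl, hu, hv⟩ := Finset.mem_filter.1 ha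
      have h0 := hpos _ haA
      exact ⟨u, Finset.mem_Icc.2 ⟨Nat.pos_of_mul_pos_right h0, Nat.le_floor hu⟩, v,
        Finset.mem_Icc.2 ⟨Nat.pos_of_mul_pos_left h0, Nat.le_floor hv⟩, rfl⟩)
  refine h.trans ?_
  have h1 := card_Icc_floor_le hx
  have h2 := card_Icc_floor_le hy
  gcongr

open Classical in
-- A single application would give w^36·w^28 = w^64. Splitting the range of u at w^46 and w^50 and
-- using uv ≤ w^80 for the larger u gives v√u terms w^59, w^59 and w^58.
theorem MulSidon.card_balanced_le {A : Finset ℕ} (hA : MulSidon (A : Set ℕ)) {n : ℕ} {w : ℝ}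
    (hw : 1 < w) (hwn : w ^ 80 = n) (hAn : A ⊆ Finset.Icc 1 n) :
    ((A.filter fun a => ∃ u v : ℕ, a = u * v ∧ (u : ℝ) ≤ w ^ 56 ∧ (v : ℝ) ≤ w ^ 36).card : ℝ)
      ≤ 6 * w ^ 59 := by
  have hw0 : 0 < w := by linarith
  have hpos : ∀ a ∈ A, 0 < a := fun a ha => (Finset.mem_Icc.1 (hAn ha)).1
  set F : ℕ → ℕ → Finset ℕ := fun i j =>
    A.filter fun a => ∃ u v : ℕ, a = u * v ∧ (u : ℝ) ≤ w ^ i ∧ (v : ℝ) ≤ w ^ j with hF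
  have hsub : (A.filter fun a => ∃ u v : ℕ, a = u * v ∧ (u : ℝ) ≤ w ^ 56 ∧ (v : ℝ) ≤ w ^ 36)
      ⊆ F 46 36 ∪ F 50 34 ∪ F 56 30 := by
    intro a ha
    obtain ⟨haA, u, v, rfl, hu, hv⟩ := Finset.mem_filter.1 ha
    have hn : (u : ℝ) * v ≤ w ^ 80 := by
      rw [hwn]; exact_mod_cast (Finset.mem_Icc.1 (hAn haA)).2
    have hv0 : (0 : ℝ) < v := by exact_mod_cast Nat.pos_of_mul_pos_left (hpos _ haA)
    have key : ∀ i j : ℕ, i + j = 80 → w ^ i < u → (v : ℝ) ≤ w ^ j := by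
      intro i j hij hi
      rw [← hij, pow_add] at hn
      by_contra! h3
      have : w ^ i * w ^ j < u * v := by apply mul_lt_mul'' hi h3 <;> positivity
      linarith
    simp only [Finset.mem_union, hF, Finset.mem_filter]
    rcases le_or_gt (u : ℝ) (w ^ 46) with h | h
    · exact Or.inl (Or.inl ⟨haA, u, v, rfl, h, hv⟩)
    rcases le_or_gt (u : ℝ) (w ^ 50) with h' | h'
    · exact Or.inl (Or.inr ⟨haA, u, v, rfl, h', key 46 34 rfl h⟩)
    · exact Or.inr ⟨haA, u, v, rfl, hu, key 50 30 rfl h'⟩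
  have hle : ∀ i j k : ℕ, i = 2 * k → i ≤ 59 → j + k ≤ 59 → ((F i j).card : ℝ) ≤ 2 * w ^ 59 := by
    intro i j k hik hi hjk
    refine (hA.card_factorable_le hpos (by positivity) (by positivity)).trans ?_
    have h1 : √(w ^ i) = w ^ k := by
      rw [hik, mul_comm, pow_mul, Real.sqrt_sq (by positivity)]
    rw [h1, ← pow_add]
    have := pow_le_pow_right₀ hw.le hi
    have := pow_le_pow_right₀ hw.le hjk
    linarith
  have h1 := hle 46 36 23 rfl (by norm_num) (by norm_num)
  have h2 := hle 50 34 25 rfl (by norm_num) (by norm_num)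
  have h3 := hle 56 30 28 rfl (by norm_num) (by norm_num)
  have h4 := (Finset.card_le_card hsub).trans ((Finset.card_union_le _ _).trans
    (Nat.add_le_add_right (Finset.card_union_le _ _) _))
  have h5 : ((A.filter fun a => ∃ u v : ℕ, a = u * v ∧ (u : ℝ) ≤ w ^ 56 ∧ (v : ℝ) ≤ w ^ 36).card : ℝ)
      ≤ (F 46 36).card + (F 50 34).card + (F 56 30).card := by exact_mod_cast h4
  linarith

/-! ### Summation over 16-adic ranges -/

/-- The right side is an increment of x/(1 + x) from x to 4x, so sums along powers of 4 telescope,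
uniformly in the starting point. -/
theorem min_pow_three_inv_le {x : ℝ} (hx : 0 < x) :
    min (x ^ 3) (1 / x) ≤ 16 / 3 * (4 * x / (1 + 4 * x) - x / (1 + x)) := by
  have h : 16 / 3 * (4 * x / (1 + 4 * x) - x / (1 + x)) = 16 * x / ((1 + 4 * x) * (1 + x)) := by
    field_simp
    ring
  rw [h, le_div_iff₀ (by positivity)]
  rcases le_total x 1 with h1 | h1
  · refine (mul_le_mul_of_nonneg_right (min_le_left _ _) (by positivity)).trans ?_
    have h2 : x ^ 2 ≤ 1 := by nlinarith
    have h3 : (1 + 4 * x) * (1 + x) ≤ 16 := by nlinarith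
    calc x ^ 3 * ((1 + 4 * x) * (1 + x)) = x ^ 2 * (x * ((1 + 4 * x) * (1 + x))) := by ring
      _ ≤ 1 * (x * 16) := by gcongr
      _ = _ := by ring
  · refine (mul_le_mul_of_nonneg_right (min_le_right _ _) (by positivity)).trans ?_
    rw [one_div_mul_eq_div, div_le_iff₀ hx]
    nlinarith

theorem sum_min_geometric_le {x : ℝ} (hx : 0 < x) (T : ℕ) :
    ∑ j ∈ Finset.range T, min ((4 ^ j * x) ^ 3) (1 / (4 ^ j * x)) ≤ 16 / 3 := by
  set g : ℕ → ℝ := fun j => 4 ^ j * x / (1 + 4 ^ j * x) with hg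
  calc ∑ j ∈ Finset.range T, min ((4 ^ j * x) ^ 3) (1 / (4 ^ j * x))
      ≤ ∑ j ∈ Finset.range T, 16 / 3 * (g (j + 1) - g j) := by
        refine Finset.sum_le_sum fun j _ => ?_
        have h := min_pow_three_inv_le (x := 4 ^ j * x) (by positivity)
        rwa [← mul_assoc, ← pow_succ'] at h
    _ = 16 / 3 * (g T - g 0) := by rw [← Finset.mul_sum, Finset.sum_range_sub]
    _ ≤ 16 / 3 := by
        have h1 : g T ≤ 1 := by
          rw [hg]; exact (div_le_one (by positivity)).2 (by linarith)
        have h2 : 0 ≤ g 0 := by rw [hg]; positivity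
        linarith

theorem sum_dyadic_min_le {w : ℝ} (hw : 0 < w) (T : ℕ) :
    ∑ i ∈ Finset.range T, ∑ j ∈ Finset.range T,
      min (16 ^ (j + 1)) (w ^ 80 / 16 ^ (i + j)) * (4 : ℝ) ^ (i + j) ≤ 171 * w ^ 60 := by
  -- In terms of X = 4^j·2^i/w^20 the two bounds become multiples of X^3 and 1/X with a spare factor
  -- 2^(-i): the sum over j telescopes and the sum over i is geometric.
  have key : ∀ i j : ℕ, min (16 ^ (j + 1)) (w ^ 80 / 16 ^ (i + j)) * (4 : ℝ) ^ (i + j)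
      ≤ 16 * w ^ 60 * (1 / 2) ^ i *
        min ((4 ^ j * (2 ^ i / w ^ 20)) ^ 3) (1 / (4 ^ j * (2 ^ i / w ^ 20))) := by
    intro i j
    rw [mul_min_of_nonneg _ _ (by positivity), min_mul_of_nonneg _ _ (by positivity)]
    have e16 : ∀ k : ℕ, (16 : ℝ) ^ k = (2 ^ k) ^ 4 := fun k => by
      rw [← pow_mul, mul_comm, pow_mul]; norm_num
    have e4 : ∀ k : ℕ, (4 : ℝ) ^ k = (2 ^ k) ^ 2 := fun k => by
      rw [← pow_mul, mul_comm, pow_mul]; norm_num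
    have e2 : ((1 : ℝ) / 2) ^ i = 1 / 2 ^ i := by rw [div_pow, one_pow]
    simp only [e2, e16, e4, pow_add]
    have hi : (0 : ℝ) < 2 ^ i := by positivity
    have hj : (0 : ℝ) < 2 ^ j := by positivity
    generalize (2 : ℝ) ^ i = I at *
    generalize (2 : ℝ) ^ j = J at *
    refine min_le_min (le_of_eq ?_) ?_
    · field_simp
      norm_num
    · have : (I * J) ^ 2 * (w ^ 80 / (I * J) ^ 4) = w ^ 60 * (1 / I) * (1 / (J ^ 2 * (I / w ^ 20))) := by
        field_simp
      have h0 : 0 ≤ w ^ 60 * (1 / I) * (1 / (J ^ 2 * (I / w ^ 20))) := by positivity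
      calc _ = (I * J) ^ 2 * (w ^ 80 / (I * J) ^ 4) := by ring
        _ ≤ _ := by rw [this]; linarith
  have hgeo : ∑ i ∈ Finset.range T, ((1 : ℝ) / 2) ^ i ≤ 2 := by
    have := geom_sum_eq (x := (1 / 2 : ℝ)) (by norm_num) T
    have h0 : (0 : ℝ) ≤ (1 / 2) ^ T := by positivity
    rw [this]
    rw [div_le_iff_of_neg (by norm_num)]
    linarith
  calc _ ≤ ∑ i ∈ Finset.range T, 16 * w ^ 60 * (1 / 2) ^ i * (16 / 3) := by
        refine Finset.sum_le_sum fun i _ => ?_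
        refine (Finset.sum_le_sum fun j _ => key i j).trans ?_
        rw [← Finset.mul_sum]
        gcongr
        exact sum_min_geometric_le (by positivity) T
    _ = 16 * w ^ 60 * (16 / 3) * ∑ i ∈ Finset.range T, (1 / 2 : ℝ) ^ i := by
        rw [Finset.mul_sum]; exact Finset.sum_congr rfl fun i _ => by ring
    _ ≤ 16 * w ^ 60 * (16 / 3) * 2 := by gcongr
    _ ≤ 171 * w ^ 60 := by
        have : 0 ≤ w ^ 60 := by positivity
        linarith

/-! ### Products of rough blocks, and the upper bound -/

theorem card_roughBlocks_le_div_log {w x : ℝ} {n : ℕ} (hn : 2 ≤ n) (hw : 1 < w)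
    (hwn : w ^ 80 = n) (hx : 0 ≤ x) (hxn : x ≤ n) :
    ((roughBlocks (w ^ 12) x).card : ℝ) ≤ 210 * (x / Real.log n) := by
  have hl : Real.log n = 80 * Real.log w := by rw [← hwn, Real.log_pow]; norm_num
  have h2 : Real.log 2 ≤ Real.log n := Real.log_le_log (by norm_num) (by exact_mod_cast hn)
  have h4 : Real.log 4 = 2 * Real.log 2 := by
    rw [← Real.log_rpow (by norm_num)]; norm_num
  have hlt := Real.log_two_lt_d9
  have hl2 : 0 < Real.log 2 := Real.log_pos (by norm_num)
  refine (card_roughBlocks_le (by omega) (one_lt_pow₀ hw (by norm_num)) hx hxn).trans ?_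
  have h12 : Real.log (w ^ 12) = 12 / 80 * Real.log n := by
    rw [Real.log_pow, hl]; norm_num; ring
  have hln : 0 < Real.log n := by linarith
  have h3 : (Real.log n + Real.log 4) / Real.log (w ^ 12) ≤ 20 := by
    rw [h12, div_le_iff₀ (by positivity), h4]
    linarith
  calc _ ≤ Real.log 4 * x / Real.log (w ^ 12) * (1 + 20) := by
        have : 0 ≤ Real.log 4 := by linarith
        have : 0 ≤ Real.log (w ^ 12) := by rw [h12]; positivity
        gcongr
    _ = Real.log 4 * 140 * (x / Real.log n) := by rw [h12]; field_simp; ring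
    _ ≤ _ := by
        gcongr
        linarith

/-- `a = m * s * t` with rough blocks `s ≥ t > H` and `m`, `s` in given `16`-adic ranges. -/
def IsBlockProduct (z H : ℝ) (i j a : ℕ) : Prop :=
  ∃ m s t : ℕ, a = m * s * t ∧ IsRoughBlock z s ∧ IsRoughBlock z t ∧ H < t ∧ t ≤ s ∧
    16 ^ i ≤ m ∧ m < 16 ^ (i + 1) ∧ 16 ^ j ≤ s ∧ s < 16 ^ (j + 1)

open Classical in
-- The edges join u = ms to v = t. The bounds t ≤ s and mst ≤ n give t ≤ Z; the rough-block density
-- enters |V| fully and |U| under the square root.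
theorem MulSidon.card_block_product_le {A : Finset ℕ} (hA : MulSidon (A : Set ℕ)) {n : ℕ} {w : ℝ}
    (hn : 2 ≤ n) (hw : 1 < w) (hwn : w ^ 80 = n) (hAn : A ⊆ Finset.Icc 1 n) (i j : ℕ) :
    ((A.filter (IsBlockProduct (w ^ 12) (w ^ 36) i j)).card : ℝ)
      ≤ 256 * w ^ 44 + 16 * 210 * √210 / (Real.log n * √(Real.log n)) *
        (min (16 ^ (j + 1)) (w ^ 80 / 16 ^ (i + j)) * (4 : ℝ) ^ (i + j)) := by
  have hw0 : 0 < w := by linarith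
  have hn0 : (0 : ℝ) < n := by exact_mod_cast (by omega : 0 < n)
  have hln : 0 < Real.log n := Real.log_pos (by exact_mod_cast (by omega : 1 < n))
  set B := A.filter (IsBlockProduct (w ^ 12) (w ^ 36) i j) with hB
  set Z : ℝ := min (16 ^ (j + 1)) (w ^ 80 / 16 ^ (i + j)) with hZ
  have hZ0 : 0 ≤ Z := by positivity
  rcases B.eq_empty_or_nonempty with hBe | ⟨a₀, ha₀⟩
  · rw [hBe]
    simp only [Finset.card_empty, Nat.cast_zero]
    positivity
  have hbase : ∀ m s t : ℕ, m * s * t ∈ A → (m : ℝ) * s * t ≤ w ^ 80 := by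
    intro m s t h
    rw [hwn]
    exact_mod_cast (Finset.mem_Icc.1 (hAn h)).2
  -- As t > w^36, a nonempty range has ms ≤ w^44. Thus the |U| term stays negligible even after
  -- summing over O((log n)^2) ranges.
  have hij : (16 : ℝ) ^ (i + j) ≤ w ^ 44 := by
    obtain ⟨hA0, m, s, t, rfl, hs, ht, htH, hts, hm1, hm2, hs1, hs2⟩ := Finset.mem_filter.1 ha₀
    have h1 := hbase m s t hA0
    have hm1' : (16 : ℝ) ^ i ≤ m := by exact_mod_cast hm1
    have hs1' : (16 : ℝ) ^ j ≤ s := by exact_mod_cast hs1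
    have h2 : (16 : ℝ) ^ i * 16 ^ j * w ^ 36 ≤ w ^ 44 * w ^ 36 := by
      calc (16 : ℝ) ^ i * 16 ^ j * w ^ 36 ≤ m * s * t := by gcongr
        _ ≤ w ^ 80 := h1
        _ = _ := by ring
    rw [pow_add]
    exact le_of_mul_le_mul_right h2 (by positivity)
  -- The cap at n serves only the rough-block estimate, which requires x ≤ n.
  set x : ℝ := min (16 ^ (j + 1)) n with hx
  have hx0 : 0 ≤ x := by positivity
  set U := ((Finset.Ico (16 ^ i) (16 ^ (i + 1))) ×ˢ roughBlocks (w ^ 12) x).image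
    (fun e => e.1 * e.2) with hU
  set V := roughBlocks (w ^ 12) Z with hV
  have hcard := hA.card_le_add_mul_sqrt (B := B) (U := U) (V := V)
    (fun a ha => (Finset.mem_Icc.1 (hAn ha)).1) (by exact_mod_cast Finset.filter_subset _ _)
    (by
      intro a ha
      obtain ⟨hA0, m, s, t, rfl, hs, ht, htH, hts, hm1, hm2, hs1, hs2⟩ := Finset.mem_filter.1 ha
      have h1 := hbase m s t hA0
      have hm0 : 1 ≤ m := Nat.one_le_pow i 16 (by norm_num) |>.trans hm1
      have ht0 := ht.pos
      refine ⟨m * s, ?_, t, ?_, rfl⟩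
      · refine Finset.mem_image.2 ⟨(m, s), Finset.mem_product.2 ⟨Finset.mem_Ico.2 ⟨hm1, hm2⟩,
          (mem_roughBlocks hx0).2 ⟨le_min (by exact_mod_cast hs2.le) ?_, hs⟩⟩, rfl⟩
        have h2 : m * s * t ≤ n := (Finset.mem_Icc.1 (hAn hA0)).2
        have h3 : s ≤ n := by
          calc s = 1 * s * 1 := by ring
            _ ≤ m * s * t := by gcongr; omega
            _ ≤ n := h2
        exact_mod_cast h3
      · refine (mem_roughBlocks hZ0).2 ⟨le_min (by exact_mod_cast hts.trans hs2.le) ?_, ht⟩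
        rw [le_div_iff₀ (by positivity)]
        have hm1' : (16 : ℝ) ^ i ≤ m := by exact_mod_cast hm1
        have hs1' : (16 : ℝ) ^ j ≤ s := by exact_mod_cast hs1
        calc (t : ℝ) * 16 ^ (i + j) = 16 ^ i * 16 ^ j * t := by ring
          _ ≤ m * s * t := by gcongr
          _ ≤ _ := h1)
  have hVc : (V.card : ℝ) ≤ 210 * (Z / Real.log n) := by
    refine card_roughBlocks_le_div_log hn hw hwn hZ0 ?_
    refine (min_le_right _ _).trans ?_
    rw [hwn]
    exact div_le_self hn0.le (one_le_pow₀ (by norm_num))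
  have hUc : (U.card : ℝ) ≤ 16 ^ (i + 1) * (roughBlocks (w ^ 12) x).card := by
    have h : U.card ≤ 16 ^ (i + 1) * (roughBlocks (w ^ 12) x).card := by
      refine Finset.card_image_le.trans ?_
      rw [Finset.card_product, Nat.card_Ico]
      gcongr
      exact Nat.sub_le _ _
    exact_mod_cast h
  have hU1 : (U.card : ℝ) ≤ 256 * 16 ^ (i + j) := by
    have h1 : ((roughBlocks (w ^ 12) x).card : ℝ) ≤ 16 ^ (j + 1) := by
      have h2 : ((roughBlocks (w ^ 12) x).card : ℝ) ≤ (Finset.Icc 1 ⌊x⌋₊).card := by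
        exact_mod_cast Finset.card_filter_le _ _
      exact h2.trans ((card_Icc_floor_le hx0).trans (min_le_left _ _))
    calc (U.card : ℝ) ≤ 16 ^ (i + 1) * 16 ^ (j + 1) := hUc.trans (by gcongr)
      _ = _ := by ring
  have hU2 : (U.card : ℝ) ≤ (16 * 4 ^ (i + j)) ^ 2 * (210 / Real.log n) := by
    calc (U.card : ℝ) ≤ 16 ^ (i + 1) * (210 * (16 ^ (j + 1) / Real.log n)) := by
          refine hUc.trans ?_
          gcongr
          refine (card_roughBlocks_le_div_log hn hw hwn hx0 (min_le_right _ _)).trans ?_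
          gcongr
          exact min_le_left _ _
      _ = _ := by
          have : (4 : ℝ) ^ (i + j) * 4 ^ (i + j) = 16 ^ i * 16 ^ j := by
            rw [← mul_pow, ← pow_add]; norm_num
          rw [mul_pow, sq ((4 : ℝ) ^ (i + j)), this]
          ring
  have hsq : √(U.card : ℝ) ≤ 16 * 4 ^ (i + j) * (√210 / √(Real.log n)) := by
    rw [← Real.sqrt_div (by norm_num), ← Real.sqrt_sq (by positivity : (0 : ℝ) ≤ 16 * 4 ^ (i + j)),
      ← Real.sqrt_mul (by positivity)]
    exact Real.sqrt_le_sqrt hU2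
  calc (B.card : ℝ) ≤ U.card + V.card * √U.card := hcard
    _ ≤ 256 * w ^ 44 + 210 * (Z / Real.log n) * (16 * 4 ^ (i + j) * (√210 / √(Real.log n))) := by
        gcongr
        exact hU1.trans (by gcongr)
    _ = _ := by
        field_simp

open Classical in
theorem MulSidon.card_le {A : Finset ℕ} (hA : MulSidon (A : Set ℕ)) {n : ℕ} {w : ℝ}
    (hn : 2 ≤ n) (hw : 1 < w) (hwn : w ^ 80 = n) (hAn : A ⊆ Finset.Icc 1 n) :
    (A.card : ℝ) ≤ Nat.primeCounting n + w ^ 48 + 6 * w ^ 59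
      + ((Nat.log 16 n + 1 : ℕ) : ℝ) ^ 2 * (256 * w ^ 44)
      + 16 * 210 * √210 / (Real.log n * √(Real.log n)) * (171 * w ^ 60) := by
  have hw0 : 0 < w := by linarith
  have hln : 0 < Real.log n := Real.log_pos (by exact_mod_cast (by omega : 1 < n))
  set T := Nat.log 16 n + 1 with hT
  set A₁ := A.filter fun a => ∃ p : ℕ, p.Prime ∧ p ∣ a ∧ w ^ 56 < p with hA₁
  set A₂ := A.filter fun a => ∃ u v : ℕ, a = u * v ∧ (u : ℝ) ≤ w ^ 56 ∧ (v : ℝ) ≤ w ^ 36 with hA₂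
  set A₃ := (Finset.range T).biUnion fun i => (Finset.range T).biUnion fun j =>
    A.filter (IsBlockProduct (w ^ 12) (w ^ 36) i j) with hA₃
  have hsub : A ⊆ A₁ ∪ A₂ ∪ A₃ := by
    intro a ha
    obtain ⟨ha0, han⟩ := Finset.mem_Icc.1 (hAn ha)
    simp only [Finset.mem_union]
    rcases rough_trichotomy hw ha0 (by rw [hwn]; exact_mod_cast han) with
      h | h | ⟨m, s, t, rfl, hs, ht, htH, hts⟩
    · exact Or.inl (Or.inl (Finset.mem_filter.2 ⟨ha, h⟩))
    · exact Or.inl (Or.inr (Finset.mem_filter.2 ⟨ha, h⟩))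
    · right
      have hs0 := hs.pos
      have ht0 := ht.pos
      have hm0 : 0 < m := Nat.pos_of_mul_pos_right (Nat.pos_of_mul_pos_right ha0)
      have hmn : m ≤ n := by
        calc m = m * 1 * 1 := by ring
          _ ≤ m * s * t := by gcongr <;> omega
          _ ≤ n := han
      have hsn : s ≤ n := by
        calc s = 1 * s * 1 := by ring
          _ ≤ m * s * t := by gcongr <;> omega
          _ ≤ n := han
      refine Finset.mem_biUnion.2 ⟨Nat.log 16 m, Finset.mem_range.2
        (Nat.lt_succ_of_le (Nat.log_mono_right hmn)), Finset.mem_biUnion.2 ⟨Nat.log 16 s,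
        Finset.mem_range.2 (Nat.lt_succ_of_le (Nat.log_mono_right hsn)),
        Finset.mem_filter.2 ⟨ha, m, s, t, rfl, hs, ht, htH, hts, ?_⟩⟩⟩
      exact ⟨Nat.pow_log_le_self 16 hm0.ne', Nat.lt_pow_succ_log_self (by norm_num) m,
        Nat.pow_log_le_self 16 hs0.ne', Nat.lt_pow_succ_log_self (by norm_num) s⟩
  have h0 : (A.card : ℝ) ≤ A₁.card + A₂.card + A₃.card := by
    have := (Finset.card_le_card hsub).trans ((Finset.card_union_le _ _).trans
      (Nat.add_le_add_right (Finset.card_union_le _ _) _))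
    exact_mod_cast this
  have h1 := hA.card_large_prime_le hw hwn hAn
  have h2 := hA.card_balanced_le hw hwn hAn
  set c := 16 * 210 * √210 / (Real.log n * √(Real.log n)) with hc
  have hc0 : 0 ≤ c := by positivity
  have h3 : (A₃.card : ℝ) ≤ (T : ℝ) ^ 2 * (256 * w ^ 44) + c * (171 * w ^ 60) := by
    calc (A₃.card : ℝ) ≤ ∑ i ∈ Finset.range T, ∑ j ∈ Finset.range T,
          ((A.filter (IsBlockProduct (w ^ 12) (w ^ 36) i j)).card : ℝ) := by
          have := Finset.card_biUnion_le.trans (Finset.sum_le_sum fun i (_ : i ∈ Finset.range T) =>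
            Finset.card_biUnion_le (s := Finset.range T)
              (t := fun j => A.filter (IsBlockProduct (w ^ 12) (w ^ 36) i j)))
          exact_mod_cast this
      _ ≤ ∑ i ∈ Finset.range T, ∑ j ∈ Finset.range T, (256 * w ^ 44 +
          c * (min (16 ^ (j + 1)) (w ^ 80 / 16 ^ (i + j)) * (4 : ℝ) ^ (i + j))) :=
          Finset.sum_le_sum fun i _ => Finset.sum_le_sum fun j _ =>
            hA.card_block_product_le hn hw hwn hAn i j
      _ = (T : ℝ) ^ 2 * (256 * w ^ 44) + c * ∑ i ∈ Finset.range T, ∑ j ∈ Finset.range T,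
          (min (16 ^ (j + 1)) (w ^ 80 / 16 ^ (i + j)) * (4 : ℝ) ^ (i + j)) := by
          simp only [Finset.sum_add_distrib, ← Finset.mul_sum, Finset.sum_const,
            Finset.card_range, nsmul_eq_mul]
          ring
      _ ≤ _ := by
          gcongr
          exact sum_dyadic_min_le hw0 T
  linarith

theorem exists_card_le_of_mulSidon : ∃ C : ℝ, 0 < C ∧ ∀ n : ℕ, 2 ≤ n → ∀ A : Finset ℕ,
    A ⊆ Finset.Icc 1 n → MulSidon (A : Set ℕ) →
      (A.card : ℝ) - Nat.primeCounting n
        ≤ C * ((n : ℝ) ^ (3 / 4 : ℝ) / Real.log n ^ (3 / 2 : ℝ)) := by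
  refine ⟨(7 + 6561 * 256) * (120 * √120) + 16 * 210 * √210 * 171, by positivity, ?_⟩
  intro n hn A hAn hA
  have hn1 : (1 : ℝ) < n := by exact_mod_cast (by omega : 1 < n)
  have hn0 : (0 : ℝ) < n := by linarith
  have hln := Real.log_pos hn1
  set w : ℝ := (n : ℝ) ^ (1 / 80 : ℝ) with hw
  have hw1 : 1 < w := Real.one_lt_rpow hn1 (by norm_num)
  have hw0 : 0 < w := by linarith
  have hwn : w ^ 80 = n := by
    rw [hw, ← Real.rpow_natCast, ← Real.rpow_mul hn0.le]; norm_num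
  have hw60 : (n : ℝ) ^ (3 / 4 : ℝ) = w ^ 60 := by
    rw [hw, ← Real.rpow_natCast, ← Real.rpow_mul hn0.le]; norm_num
  have hl32 : Real.log n ^ (3 / 2 : ℝ) = Real.log n * √(Real.log n) := by
    rw [Real.sqrt_eq_rpow, ← Real.rpow_one_add' hln.le (by norm_num)]; norm_num
  have hl : Real.log n = 80 * Real.log w := by rw [← hwn, Real.log_pow]; norm_num
  -- The exponent 2/3 makes (log n)^(3/2) = O(w), which lets w^60/(log n)^(3/2) absorb every w^59
  -- term; 120 = 80/(2/3).
  have hlw : Real.log n ≤ 120 * w ^ (2 / 3 : ℝ) := by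
    have := Real.log_le_rpow_div hw0.le (by norm_num : (0 : ℝ) < 2 / 3)
    rw [hl]; linarith
  have hlog : Real.log n * √(Real.log n) ≤ 120 * √120 * w := by
    calc Real.log n * √(Real.log n) ≤ (120 * w ^ (2 / 3 : ℝ)) * √(120 * w ^ (2 / 3 : ℝ)) := by
          gcongr
      _ = _ := by
          rw [Real.sqrt_mul (by norm_num), Real.sqrt_eq_rpow (w ^ _), ← Real.rpow_mul hw0.le]
          calc _ = 120 * √120 * (w ^ (2 / 3 : ℝ) * w ^ (2 / 3 * (1 / 2) : ℝ)) := by ring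
            _ = _ := by rw [← Real.rpow_add hw0]; norm_num
  have hT : ((Nat.log 16 n + 1 : ℕ) : ℝ) ≤ 81 * w := by
    have h1 : ((Nat.log 16 n : ℕ) : ℝ) ≤ Real.log n := by
      have h2 : (16 : ℝ) ^ Nat.log 16 n ≤ n := by
        exact_mod_cast Nat.pow_log_le_self 16 (by omega)
      have h3 := Real.log_le_log (by positivity) h2
      rw [Real.log_pow] at h3
      have h4 : (1 : ℝ) ≤ Real.log 16 := by
        rw [Real.le_log_iff_exp_le (by norm_num)]
        linarith [Real.exp_one_lt_d9]
      have : (0 : ℝ) ≤ Nat.log 16 n := Nat.cast_nonneg _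
      nlinarith
    have h5 := Real.log_le_sub_one_of_pos hw0
    push_cast
    linarith
  have h := hA.card_le hn hw1 hwn hAn
  rw [hw60, hl32]
  set ℓ := Real.log n * √(Real.log n) with hℓ
  have hℓ0 : 0 < ℓ := by positivity
  have e1 : w ^ 48 ≤ w ^ 59 := pow_le_pow_right₀ hw1.le (by norm_num)
  have e2 : ((Nat.log 16 n + 1 : ℕ) : ℝ) ^ 2 * (256 * w ^ 44) ≤ 6561 * 256 * w ^ 59 := by
    calc ((Nat.log 16 n + 1 : ℕ) : ℝ) ^ 2 * (256 * w ^ 44) ≤ (81 * w) ^ 2 * (256 * w ^ 44) := by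
          gcongr
      _ = 6561 * 256 * w ^ 46 := by ring
      _ ≤ _ := by
          gcongr
          · exact hw1.le
          · norm_num
  have e3 : w ^ 59 ≤ 120 * √120 * (w ^ 60 / ℓ) := by
    rw [← mul_div_assoc, le_div_iff₀ hℓ0]
    calc w ^ 59 * ℓ ≤ w ^ 59 * (120 * √120 * w) := by gcongr
      _ = _ := by ring
  calc (A.card : ℝ) - Nat.primeCounting n
      ≤ (7 + 6561 * 256) * w ^ 59 + 16 * 210 * √210 / ℓ * (171 * w ^ 60) := by linarith
    _ ≤ (7 + 6561 * 256) * (120 * √120 * (w ^ 60 / ℓ)) + 16 * 210 * √210 / ℓ * (171 * w ^ 60) := by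
        gcongr
    _ = _ := by ring

/-! ### Small bipartite multigraphs with degrees divisible by 3 -/

section Degree

variable {ι α β : Type*} [DecidableEq α] [DecidableEq β]

theorem exists_not_dvd_of_not_dvd_fiber {d : ℕ} (I : Finset ι) (f : ι → α) (g : ι → β)
    {x : α} {y : β} (hx : d ∣ (I.filter fun i => f i = x).card)
    (h : ¬ d ∣ (I.filter fun i => f i = x ∧ g i = y).card) :
    ∃ y', y' ≠ y ∧ ¬ d ∣ (I.filter fun i => f i = x ∧ g i = y').card := by
  by_contra! hcon
  apply h
  have hsum : (I.filter fun i => f i = x).card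
      = ∑ y' ∈ insert y (I.image g), (I.filter fun i => f i = x ∧ g i = y').card := by
    rw [Finset.card_eq_sum_card_fiberwise (f := g) (t := insert y (I.image g))]
    · simp only [Finset.filter_filter]
    · intro i hi
      have := (Finset.mem_filter.1 hi).1
      simp only [Finset.coe_insert, Finset.coe_image, Set.mem_insert_iff]
      exact Or.inr ⟨i, this, rfl⟩
  rw [hsum, ← Finset.add_sum_erase _ _ (Finset.mem_insert_self _ _)] at hx
  refine (Nat.dvd_add_left (Finset.dvd_sum fun y' hy' => ?_)).1 hx
  exact hcon y' (Finset.ne_of_mem_erase hy')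

/-- From a cell of bad multiplicity one moves to another bad cell in its row, then from each of the
two to a bad cell elsewhere in its column. If the two new rows agree there is a rectangle; otherwise
three rows contain at least 3 edges each, and 9 > 6. -/
theorem three_dvd_card_of_rectangle_free (I : Finset ι) (hI : I.card ≤ 6) (f : ι → α) (g : ι → β)
    (hf : ∀ x, 3 ∣ (I.filter fun i => f i = x).card)
    (hg : ∀ y, 3 ∣ (I.filter fun i => g i = y).card)
    (hrect : ∀ i ∈ I, ∀ j ∈ I, ∀ k ∈ I, ∀ l ∈ I, f i = f j → f k = f l → g i = g k → g j = g l →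
      f i = f k ∨ g i = g j) (x : α) (y : β) :
    3 ∣ (I.filter fun i => f i = x ∧ g i = y).card := by
  classical
  have hex : ∀ {x y}, ¬ 3 ∣ (I.filter fun i => f i = x ∧ g i = y).card →
      ∃ i ∈ I, f i = x ∧ g i = y := by
    intro x y h
    have : (I.filter fun i => f i = x ∧ g i = y).Nonempty := by
      rw [Finset.nonempty_iff_ne_empty]
      intro h0
      rw [h0] at h
      simp at h
    obtain ⟨i, hi⟩ := this
    exact ⟨i, Finset.mem_filter.1 hi⟩
  have hcol : ∀ {x y}, ¬ 3 ∣ (I.filter fun i => f i = x ∧ g i = y).card →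
      ∃ x', x' ≠ x ∧ ¬ 3 ∣ (I.filter fun i => f i = x' ∧ g i = y).card := by
    intro x y h
    simp only [and_comm (a := f _ = _)] at h ⊢
    exact exists_not_dvd_of_not_dvd_fiber I g f (hg y) h
  have hdeg : ∀ {x y}, ¬ 3 ∣ (I.filter fun i => f i = x ∧ g i = y).card →
      3 ≤ (I.filter fun i => f i = x).card := by
    intro x y h
    obtain ⟨i, hi, hx, -⟩ := hex h
    exact Nat.le_of_dvd (Finset.card_pos.2 ⟨i, Finset.mem_filter.2 ⟨hi, hx⟩⟩) (hf x)
  by_contra h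
  obtain ⟨y', hy', h'⟩ := exists_not_dvd_of_not_dvd_fiber I f g (hf x) h
  obtain ⟨x₁, hx₁, h₁⟩ := hcol h
  obtain ⟨x₂, hx₂, h₂⟩ := hcol h'
  by_cases hxx : x₁ = x₂
  · subst hxx
    obtain ⟨i, hi, rfl, rfl⟩ := hex h
    obtain ⟨j, hj, hj1, rfl⟩ := hex h'
    obtain ⟨k, hk, rfl, hk2⟩ := hex h₁
    obtain ⟨l, hl, hl1, hl2⟩ := hex h₂
    rcases hrect i hi j hj k hk l hl hj1.symm hl1.symm hk2.symm hl2.symm with e | e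
    · exact hx₁ e.symm
    · exact hy' e.symm
  · have hsum : ∑ z ∈ {x, x₁, x₂}, (I.filter fun i => f i = z).card ≤ I.card := by
      rw [← Finset.card_biUnion]
      · exact Finset.card_le_card (Finset.biUnion_subset.2 fun z _ => Finset.filter_subset _ _)
      · intro a _ b _ hab
        rw [Function.onFun, Finset.disjoint_filter]
        intro i _ ha hb
        exact hab (ha.symm.trans hb)
    rw [Finset.sum_insert (by simp [Ne.symm hx₁, Ne.symm hx₂]), Finset.sum_pair hxx] at hsum
    have := hdeg h
    have := hdeg h₁
    have := hdeg h₂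
    omega

end Degree

/-! ### The incidence construction -/

theorem dvd_sum_factorization_of_prod_eq_pow {k d : ℕ} {a : Fin k → ℕ} (ha : ∀ i, a i ≠ 0)
    (h : ∃ x : ℤ, ∏ i, (a i : ℤ) = x ^ d) (r : ℕ) : d ∣ ∑ i, (a i).factorization r := by
  obtain ⟨x, hx⟩ := h
  have h1 : ∏ i, a i = x.natAbs ^ d := by
    have := congrArg Int.natAbs hx
    rwa [← Nat.cast_prod, Int.natAbs_natCast, Int.natAbs_pow] at this
  have h2 : (∏ i, a i).factorization r = ∑ i, (a i).factorization r := by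
    rw [Nat.factorization_prod fun i _ => ha i]
    simp
  rw [← h2, h1, Nat.factorization_pow]
  exact ⟨_, rfl⟩

theorem Nat.Prime.factorization_mul_prime {p q : ℕ} (hp : p.Prime) (hq : q.Prime) (r : ℕ) :
    (p * q).factorization r = (if p = r then 1 else 0) + (if q = r then 1 else 0) := by
  rw [Nat.factorization_mul hp.ne_zero hq.ne_zero, hp.factorization, hq.factorization]
  simp [Finsupp.single_apply]

/-- The number `1`, the primes in `(N, n]`, and the products of two primes `f P ≤ N`, `h L ≤ N`
taken over the edges `(P, L)` of a bipartite graph without rectangles. -/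
theorem incidence_mem_gammaFamily {α β : Type*} [DecidableEq α] [DecidableEq β] {N n : ℕ}
    (f : α → ℕ) (h : β → ℕ) (hf : Function.Injective f) (hh : Function.Injective h)
    (hfp : ∀ x, (f x).Prime ∧ f x ≤ N) (hhp : ∀ y, (h y).Prime ∧ h y ≤ N)
    (hfh : ∀ x y, f x ≠ h y) (E : Finset (α × β))
    (hrect : ∀ u₁ u₂ v₁ v₂, (u₁, v₁) ∈ E → (u₁, v₂) ∈ E → (u₂, v₁) ∈ E → (u₂, v₂) ∈ E →
      u₁ = u₂ ∨ v₁ = v₂) :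
    ((insert 1 (E.image (fun e => f e.1 * h e.2) ∪ (Nat.primesLE n).filter (N < ·)) : Finset ℕ) :
      Set ℕ) ∈ gammaFamily 6 3 := by
  have hmem : ∀ m ∈ (insert 1 (E.image (fun e => f e.1 * h e.2) ∪
      (Nat.primesLE n).filter (N < ·)) : Finset ℕ),
      m = 1 ∨ (∃ e ∈ E, m = f e.1 * h e.2) ∨ (m.Prime ∧ N < m) := by
    intro m hm
    simp only [Finset.mem_insert, Finset.mem_union, Finset.mem_image, Finset.mem_filter,
      Nat.mem_primesLE] at hm
    rcases hm with hm | ⟨e, he, rfl⟩ | hm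
    · exact Or.inl hm
    · exact Or.inr (Or.inl ⟨e, he, rfl⟩)
    · exact Or.inr (Or.inr ⟨hm.1.2, hm.2⟩)
  have hpos : ∀ m ∈ (insert 1 (E.image (fun e => f e.1 * h e.2) ∪
      (Nat.primesLE n).filter (N < ·)) : Finset ℕ), 0 < m := by
    intro m hm
    rcases hmem m hm with rfl | ⟨e, -, rfl⟩ | hm
    · exact one_pos
    · exact Nat.mul_pos (hfp _).1.pos (hhp _).1.pos
    · exact hm.1.pos
  refine ⟨fun m hm => hpos m hm, fun a ha hx => ?_⟩
  have hfac := dvd_sum_factorization_of_prod_eq_pow (fun i => (hpos _ (ha i)).ne') hx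
  have hcases := fun i => hmem _ (ha i)
  set I := Finset.univ.filter fun i => ∃ e ∈ E, a i = f e.1 * h e.2 with hI
  have hex : ∀ i ∈ I, ∃ e ∈ E, a i = f e.1 * h e.2 := fun i hi => (Finset.mem_filter.1 hi).2
  have hNotI : ∀ i, i ∉ I → a i = 1 ∨ ((a i).Prime ∧ N < a i) := by
    intro i hi
    rcases hcases i with h1 | h1 | h1
    · exact Or.inl h1
    · exact absurd (Finset.mem_filter.2 ⟨Finset.mem_univ i, h1⟩) hi
    · exact Or.inr h1
  have hnotI_fac : ∀ i, i ∉ I → ∀ r, r ≤ N → (a i).factorization r = 0 := by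
    intro i hi r hr
    rcases hNotI i hi with h1 | ⟨h1, h2⟩
    · simp [h1]
    · rw [h1.factorization, Finsupp.single_apply, if_neg (by omega)]
  have hlarge : ∀ q, q.Prime → N < q → 3 ∣ (Finset.univ.filter fun i => a i = q).card := by
    intro q hq hqN
    have h1 := hfac q
    rw [Finset.card_filter]
    convert h1 using 1
    refine Finset.sum_congr rfl fun i _ => ?_
    rcases hcases i with h1 | ⟨e, -, h1⟩ | ⟨h1, -⟩
    · rw [h1, if_neg hq.one_lt.ne]; simp
    · have := (hfp e.1).2
      have := (hhp e.2).2
      rw [h1, (hfp e.1).1.factorization_mul_prime (hhp e.2).1,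
        if_neg (by omega : ¬ f e.1 = q), if_neg (by omega : ¬ h e.2 = q), if_neg]
      rintro rfl
      exact Nat.not_prime_mul (hfp e.1).1.ne_one (hhp e.2).1.ne_one hq
    · rw [h1.factorization, Finsupp.single_apply]
  have hall : ∀ y, y ≠ 1 → 3 ∣ (Finset.univ.filter fun i => a i = y).card := by
    intro y hy
    by_cases hyE : ∃ e ∈ E, y = f e.1 * h e.2
    · obtain ⟨e₀, he₀, rfl⟩ := hyE
      have : Nonempty (α × β) := ⟨e₀⟩
      choose! g hgE hg using hex
      -- The exponent of the prime f x in the product is the degree of x: members outside I are 1 or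
      -- primes above N, and f x is never a value of h.
      have hfst : ∀ x, 3 ∣ (I.filter fun i => (g i).1 = x).card := by
        intro x
        have h1 := hfac (f x)
        rw [← Finset.sum_subset (Finset.subset_univ I) fun i _ hi =>
          hnotI_fac i hi _ (hfp x).2] at h1
        rw [Finset.card_filter]
        convert h1 using 1
        refine Finset.sum_congr rfl fun i hi => ?_
        rw [hg i hi, (hfp _).1.factorization_mul_prime (hhp _).1, if_neg (hfh x _).symm, add_zero]
        simp only [hf.eq_iff]
      have hsnd : ∀ y, 3 ∣ (I.filter fun i => (g i).2 = y).card := by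
        intro y
        have h1 := hfac (h y)
        rw [← Finset.sum_subset (Finset.subset_univ I) fun i _ hi =>
          hnotI_fac i hi _ (hhp y).2] at h1
        rw [Finset.card_filter]
        convert h1 using 1
        refine Finset.sum_congr rfl fun i hi => ?_
        rw [hg i hi, (hfp _).1.factorization_mul_prime (hhp _).1, if_neg (hfh _ y), zero_add]
        simp only [hh.eq_iff]
      have key := three_dvd_card_of_rectangle_free I
        ((Finset.card_filter_le _ _).trans (by simp)) (fun i => (g i).1) (fun i => (g i).2)
        hfst hsnd (by
          intro i hi j hj k hk l hl h1 h2 h3 h4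
          have mi := hgE i hi
          have mj := hgE j hj
          have mk := hgE k hk
          have ml := hgE l hl
          refine hrect (g i).1 (g k).1 (g i).2 (g j).2 mi ?_ ?_ ?_
          · rw [h1]; exact mj
          · rw [h3]; exact mk
          · rw [h2, h4]; exact ml) e₀.1 e₀.2
      convert key using 2
      ext i
      simp only [Finset.mem_filter, Finset.mem_univ, true_and]
      constructor
      · intro hi
        have hiI : i ∈ I := Finset.mem_filter.2 ⟨Finset.mem_univ i, e₀, he₀, hi⟩
        have h1 := congrArg (fun m => m.factorization (f e₀.1)) ((hg i hiI).symm.trans hi)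
        have h2 := congrArg (fun m => m.factorization (h e₀.2)) ((hg i hiI).symm.trans hi)
        simp only [(hfp _).1.factorization_mul_prime (hhp _).1, hf.eq_iff, hh.eq_iff,
          (hfh _ _).symm, hfh _ _, if_true, if_false] at h1 h2
        refine ⟨hiI, ?_, ?_⟩
        · by_contra hne; simp [hne] at h1
        · by_contra hne; simp [hne] at h2
      · rintro ⟨hiI, h1, h2⟩
        rw [hg i hiI, h1, h2]
    · by_cases hyp : y.Prime ∧ N < y
      · exact hlarge y hyp.1 hyp.2
      · rw [Finset.filter_eq_empty_iff.2]
        · simp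
        · rintro i - rfl
          rcases hcases i with h1 | h1 | h1
          exacts [hy h1, hyE h1, hyp h1]
  refine isTrivialFamily_of_dvd_card fun y => ?_
  by_cases hy : y = 1
  -- The value 1 is invisible to factorizations; its multiplicity is 6 minus multiples of 3.
  · subst hy
    have h6 : (Finset.univ : Finset (Fin 6)).card
        = ∑ y ∈ insert 1 (Finset.univ.image a), (Finset.univ.filter fun i => a i = y).card :=
      Finset.card_eq_sum_card_fiberwise fun i _ => by simp
    rw [← Finset.add_sum_erase _ _ (Finset.mem_insert_self _ _)] at h6
    have h3 : 3 ∣ (Finset.univ : Finset (Fin 6)).card := by simp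
    rw [h6] at h3
    exact (Nat.dvd_add_left (Finset.dvd_sum fun y hy =>
      hall y (Finset.ne_of_mem_erase hy))).1 h3
  · exact hall y hy

/-- The primes up to N are traded for the edges; the extra element 1 makes the inequality strict. -/
theorem card_add_primeCounting_lt_fMax_add {α β : Type*} [DecidableEq α] [DecidableEq β]
    {N n : ℕ} (hNn : N * N ≤ n) (hn : 0 < n)
    (f : α → ℕ) (h : β → ℕ) (hf : Function.Injective f) (hh : Function.Injective h)
    (hfp : ∀ x, (f x).Prime ∧ f x ≤ N) (hhp : ∀ y, (h y).Prime ∧ h y ≤ N)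
    (hfh : ∀ x y, f x ≠ h y) (E : Finset (α × β))
    (hrect : ∀ u₁ u₂ v₁ v₂, (u₁, v₁) ∈ E → (u₁, v₂) ∈ E → (u₂, v₁) ∈ E → (u₂, v₂) ∈ E →
      u₁ = u₂ ∨ v₁ = v₂) :
    E.card + Nat.primeCounting n < fMax 6 3 n + Nat.primeCounting N := by
  have hA := incidence_mem_gammaFamily (n := n) f h hf hh hfp hhp hfh E hrect
  set A := (insert 1 (E.image (fun e => f e.1 * h e.2) ∪ (Nat.primesLE n).filter (N < ·)) :
    Finset ℕ) with hAdef
  have hle := (isGreatest_fMax 6 3 n).2 ⟨A, ?_, hA, rfl⟩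
  · have h1 : A.card = E.card + ((Nat.primesLE n).filter (N < ·)).card + 1 := by
      rw [hAdef, Finset.card_insert_of_notMem, Finset.card_union_of_disjoint,
        Finset.card_image_of_injOn]
      · rintro ⟨x, y⟩ - ⟨x', y'⟩ - he
        have h1 := congrArg (fun m => m.factorization (f x)) he
        have h2 := congrArg (fun m => m.factorization (h y)) he
        simp only [(hfp _).1.factorization_mul_prime (hhp _).1, hf.eq_iff, hh.eq_iff,
          (hfh _ _).symm, hfh _ _, if_true, if_false] at h1 h2
        have hx : x' = x := by by_contra hne; simp [hne] at h1
        have hy : y' = y := by by_contra hne; simp [hne] at h2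
        rw [hx, hy]
      · rw [Finset.disjoint_left]
        intro m hm hm'
        obtain ⟨e, -, rfl⟩ := Finset.mem_image.1 hm
        exact Nat.not_prime_mul (hfp e.1).1.ne_one (hhp e.2).1.ne_one
          (Nat.mem_primesLE.1 (Finset.mem_filter.1 hm').1).2
      · simp only [Finset.mem_union, Finset.mem_image, Finset.mem_filter, Nat.mem_primesLE, not_or]
        refine ⟨?_, fun h => Nat.not_prime_one h.1.2⟩
        rintro ⟨e, -, he⟩
        exact (hfp e.1).1.ne_one (Nat.eq_one_of_mul_eq_one_right he)
    have h2 : Nat.primeCounting n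
        ≤ Nat.primeCounting N + ((Nat.primesLE n).filter (N < ·)).card := by
      rw [← Nat.primesLE_card_eq_primeCounting, ← Nat.primesLE_card_eq_primeCounting]
      refine (Finset.card_le_card (t := Nat.primesLE N ∪ (Nat.primesLE n).filter (N < ·)) ?_).trans
        (Finset.card_union_le _ _)
      intro q hq
      simp only [Finset.mem_union, Finset.mem_filter, Nat.mem_primesLE] at hq ⊢
      by_cases hqN : N < q
      · exact Or.inr ⟨hq, hqN⟩
      · exact Or.inl ⟨not_lt.1 hqN, hq.2⟩
    omega
  · intro m hm
    rw [hAdef] at hm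
    simp only [Finset.mem_insert, Finset.mem_union, Finset.mem_image, Finset.mem_filter,
      Nat.mem_primesLE] at hm
    rw [Finset.mem_Icc]
    rcases hm with rfl | ⟨e, -, rfl⟩ | hm
    · exact ⟨le_rfl, hn⟩
    · exact ⟨Nat.mul_pos (hfp _).1.pos (hhp _).1.pos,
        (Nat.mul_le_mul (hfp _).2 (hhp _).2).trans hNn⟩
    · exact ⟨hm.1.2.pos, hm.1.1⟩

theorem primeCounting_lt_fMax {n : ℕ} (hn : 0 < n) : Nat.primeCounting n < fMax 6 3 n := by
  have h := card_add_primeCounting_lt_fMax_add (α := Empty) (β := Empty) (N := 1) (n := n)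
    (by omega) hn Empty.elim Empty.elim (fun x => x.elim) (fun x => x.elim) (fun x => x.elim)
    (fun x => x.elim) (fun x => x.elim) ∅ (fun x => x.elim)
  simpa using h

/-- The incidence graph of points and non-vertical lines of the affine plane over `ZMod p`. -/
theorem pow_three_add_primeCounting_lt {n p : ℕ} (hn : 0 < n) (hp : p.Prime)
    (hcard : 2 * p ^ 2 ≤ Nat.primeCounting n.sqrt) :
    p ^ 3 + Nat.primeCounting n < fMax 6 3 n + Nat.primeCounting n.sqrt := by
  have : Fact p.Prime := ⟨hp⟩
  obtain ⟨φ⟩ : Nonempty ((ZMod p × ZMod p) ⊕ (ZMod p × ZMod p) ↪ Nat.primesLE n.sqrt) := by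
    apply Function.Embedding.nonempty_of_card_le
    rw [Fintype.card_coe, Nat.primesLE_card_eq_primeCounting]
    simp only [Fintype.card_sum, Fintype.card_prod, ZMod.card]
    linarith
  have hφ : Function.Injective fun x => (φ x : ℕ) := Subtype.val_injective.comp φ.injective
  have hprime : ∀ x, (φ x : ℕ).Prime ∧ (φ x : ℕ) ≤ n.sqrt := fun x =>
    ⟨(Nat.mem_primesLE.1 (φ x).2).2, (Nat.mem_primesLE.1 (φ x).2).1⟩
  -- A point on a non-vertical line is given by its abscissa and the line, hence p^3 incidences.
  set E : Finset ((ZMod p × ZMod p) × (ZMod p × ZMod p)) :=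
    (Finset.univ : Finset (ZMod p × ZMod p × ZMod p)).image
      (fun e => ((e.1, e.2.1 * e.1 + e.2.2), e.2)) with hE
  have hEc : E.card = p ^ 3 := by
    rw [hE, Finset.card_image_of_injective]
    · simp only [Finset.card_univ, Fintype.card_prod, ZMod.card]
      ring
    · rintro ⟨x, l⟩ ⟨x', l'⟩ h
      simp only [Prod.mk.injEq] at h
      simp [h.1.1, h.2]
  have hmem : ∀ x y a b : ZMod p, ((x, y), (a, b)) ∈ E → y = a * x + b := by
    intro x y a b h
    obtain ⟨e, -, he⟩ := Finset.mem_image.1 h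
    simp only [Prod.mk.injEq] at he
    obtain ⟨⟨h1, h2⟩, h3⟩ := he
    rw [← h1, ← h2, h3]
  have h := card_add_primeCounting_lt_fMax_add (Nat.sqrt_le n) hn
    (fun x => (φ (Sum.inl x) : ℕ)) (fun x => (φ (Sum.inr x) : ℕ))
    (fun x y h => Sum.inl_injective (hφ h)) (fun x y h => Sum.inr_injective (hφ h))
    (fun x => hprime _) (fun x => hprime _) (fun x y h => by simpa using hφ h) E
    (by
      rintro ⟨x, y⟩ ⟨x', y'⟩ ⟨a, b⟩ ⟨a', b'⟩ h11 h12 h21 h22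
      have e11 := hmem _ _ _ _ h11
      have e12 := hmem _ _ _ _ h12
      have e21 := hmem _ _ _ _ h21
      have e22 := hmem _ _ _ _ h22
      have h0 : (a - a') * (x - x') = 0 := by linear_combination e12 - e11 + e21 - e22
      rcases mul_eq_zero.1 h0 with h | h
      · right
        have ha : a = a' := sub_eq_zero.1 h
        subst ha
        simp only [Prod.mk.injEq, true_and]
        linear_combination e12 - e11
      · left
        have hx : x = x' := sub_eq_zero.1 h
        subst hx
        simp only [Prod.mk.injEq, true_and]
        linear_combination e11 - e21)
  rwa [hEc] at h

/-! ### Quantitative lower bound and conclusion -/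

theorem div_log_le_primeCounting_sqrt {n : ℕ} (h : 20 ≤ n.sqrt) :
    0.3 * (√n / Real.log n) ≤ Nat.primeCounting n.sqrt := by
  set N := n.sqrt with hN
  have hN20 : (20 : ℝ) ≤ N := by exact_mod_cast h
  have hN0 : (0 : ℝ) < N := by linarith
  have hNn : (N : ℝ) * N ≤ n := by exact_mod_cast Nat.sqrt_le n
  have hnN : √(n : ℝ) ≤ N + 1 := by
    rw [Real.sqrt_le_left (by positivity)]
    have : n ≤ (N + 1) ^ 2 := by rw [sq]; exact (Nat.lt_succ_sqrt n).le
    exact_mod_cast this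
  have hl2 := Real.log_two_gt_d9
  have hl2' := Real.log_two_lt_d9
  have hlN : 0 < Real.log N := Real.log_pos (by linarith)
  -- The tangent to the logarithm at 16 suffices for N ≥ 20.
  have h1 : Real.log (N + 1) ≤ 0.34 * N := by
    have h2 := Real.log_le_sub_one_of_pos (x := ((N : ℝ) + 1) / 16) (by positivity)
    rw [Real.log_div (by positivity) (by norm_num)] at h2
    have h16 : Real.log 16 = 4 * Real.log 2 := by
      rw [← Real.log_rpow (by norm_num)]; norm_num
    linarith
  have h2 := Chebyshev.pi_ge N
  rw [div_le_iff₀ hlN] at h2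
  have h3 : 0.35 * N ≤ Nat.primeCounting N * Real.log N := by nlinarith
  have h4 : 2 * Real.log N ≤ Real.log n := by
    have := Real.log_le_log (by positivity) hNn
    rw [Real.log_mul hN0.ne' hN0.ne'] at this
    linarith
  rw [← mul_div_assoc, div_le_iff₀ (by linarith)]
  have h5 : (0 : ℝ) ≤ Nat.primeCounting N := Nat.cast_nonneg _
  nlinarith

theorem exists_prime_sq_le_of_large {k : ℕ} (hk : 8 ≤ k) :
    ∃ p : ℕ, p.Prime ∧ 2 * p ^ 2 ≤ k ∧ (k / 8 : ℝ) * √(k / 8) ≤ (p : ℝ) ^ 3 := by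
  have hm : (k / 8).sqrt ≠ 0 := by
    rw [Ne, Nat.sqrt_eq_zero]
    omega
  obtain ⟨p, hp, hmp, hpm⟩ := Nat.exists_prime_lt_and_le_two_mul _ hm
  -- Bertrand's postulate places p in (r, 2r], where r is the integer square root of ⌊k/8⌋; the 8 is
  -- what 2(2r)^2 ≤ k needs.
  have h1 : (k / 8).sqrt * (k / 8).sqrt ≤ k / 8 := Nat.sqrt_le _
  have h2 : k / 8 < p * p := Nat.sqrt_lt.1 hmp
  have h3 : (k / 8 : ℝ) ≤ p ^ 2 := by
    have : k ≤ 8 * (p * p) := by omega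
    have : (k : ℝ) ≤ 8 * (p * p) := by exact_mod_cast this
    linarith
  refine ⟨p, hp, ?_, ?_⟩
  · calc 2 * p ^ 2 ≤ 2 * (2 * (k / 8).sqrt) ^ 2 := by gcongr
      _ = 8 * ((k / 8).sqrt * (k / 8).sqrt) := by ring
      _ ≤ 8 * (k / 8) := by gcongr
      _ ≤ k := Nat.mul_div_le k 8
  · have h4 : √(k / 8 : ℝ) ≤ p := by
      rw [Real.sqrt_le_left (Nat.cast_nonneg p)]; exact h3
    calc (k / 8 : ℝ) * √(k / 8) ≤ p ^ 2 * p := by gcongr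
      _ = _ := by ring

theorem le_fMax_sub_primeCounting {n : ℕ} (hk : 2100 ≤ Nat.primeCounting n.sqrt) :
    0.03 * √0.03 / 2 * ((n : ℝ) ^ (3 / 4 : ℝ) / Real.log n ^ (3 / 2 : ℝ))
      < (fMax 6 3 n : ℝ) - Nat.primeCounting n := by
  set k := Nat.primeCounting n.sqrt with hkdef
  have hN : k ≤ n.sqrt := by
    rw [hkdef, ← Nat.primesLE_card_eq_primeCounting]
    have : Nat.primesLE n.sqrt ⊆ Finset.Icc 1 n.sqrt := fun p hp => by
      rw [Nat.mem_primesLE] at hp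
      exact Finset.mem_Icc.2 ⟨hp.2.pos, hp.1⟩
    simpa using Finset.card_le_card this
  have hn : 2 ≤ n := by have := Nat.sqrt_le_self n; omega
  have hn0 : (0 : ℝ) ≤ n := Nat.cast_nonneg n
  have hln : 0 < Real.log n := Real.log_pos (by exact_mod_cast (by omega : 1 < n))
  obtain ⟨p, hp, hpk, hpk'⟩ := exists_prime_sq_le_of_large (k := k) (by omega)
  have h := pow_three_add_primeCounting_lt (by omega) hp hpk
  have h' : (p : ℝ) ^ 3 + Nat.primeCounting n < fMax 6 3 n + k := by exact_mod_cast h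
  have hk' : (2100 : ℝ) ≤ k := by exact_mod_cast hk
  have hs : (16 : ℝ) ≤ √(k / 8) := by
    apply Real.le_sqrt_of_sq_le
    linarith
  have hkr : 0.03 * (√n / Real.log n) ≤ k / 8 := by
    -- The factor 0.03 is a rounding down of 0.3/8.
    have := div_log_le_primeCounting_sqrt (n := n) (by omega)
    have h0 : 0 ≤ √(n : ℝ) / Real.log n := by positivity
    linarith
  have hmain : 0.03 * √0.03 * ((n : ℝ) ^ (3 / 4 : ℝ) / Real.log n ^ (3 / 2 : ℝ))
      ≤ (k / 8 : ℝ) * √(k / 8) := by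
    have hl32 : Real.log n ^ (3 / 2 : ℝ) = Real.log n * √(Real.log n) := by
      rw [Real.sqrt_eq_rpow, ← Real.rpow_one_add' hln.le (by norm_num)]; norm_num
    have hn34 : (n : ℝ) ^ (3 / 4 : ℝ) = √n * √(√n) := by
      rw [Real.sqrt_eq_rpow, Real.sqrt_eq_rpow, ← Real.rpow_mul hn0,
        ← Real.rpow_add' hn0 (by norm_num)]
      norm_num
    calc 0.03 * √0.03 * ((n : ℝ) ^ (3 / 4 : ℝ) / Real.log n ^ (3 / 2 : ℝ))
        = (0.03 * (√n / Real.log n)) * √(0.03 * (√n / Real.log n)) := by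
          rw [hl32, hn34, Real.sqrt_mul (by norm_num), Real.sqrt_div (by positivity)]
          field_simp
      _ ≤ _ := by gcongr
  -- Since √(k/8) ≥ 16, the main term (k/8)√(k/8) is at least 2k, so the loss k costs at most half
  -- of it. This is where k ≥ 2100 > 8·16^2 is used.
  nlinarith

theorem exists_le_fMax_sub_primeCounting : ∃ c : ℝ, 0 < c ∧ ∀ n : ℕ, 2 ≤ n →
    c * ((n : ℝ) ^ (3 / 4 : ℝ) / Real.log n ^ (3 / 2 : ℝ))
      < (fMax 6 3 n : ℝ) - Nat.primeCounting n := by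
  have hsqrt : Filter.Tendsto Nat.sqrt Filter.atTop Filter.atTop :=
    Filter.tendsto_atTop_atTop.2 fun b => ⟨b * b, fun a ha => Nat.le_sqrt.2 ha⟩
  obtain ⟨n₀, hn₀⟩ := Filter.eventually_atTop.1
    ((Nat.tendsto_primeCounting.comp hsqrt).eventually_ge_atTop 2100)
  set M : ℝ := ((n₀ : ℝ) + 1) ^ (3 / 4 : ℝ) / Real.log 2 ^ (3 / 2 : ℝ) with hM
  have hl2 : 0 < Real.log 2 := Real.log_pos (by norm_num)
  have hM0 : 0 < M := by positivity
  -- For n < n₀ the growth function is at most M, and the surplus of at least 1 over π(n) beats c·M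
  -- ≤ 1/2.
  refine ⟨min (0.03 * √0.03 / 2) (1 / (2 * M)), by positivity, fun n hn => ?_⟩
  have hl : Real.log 2 ≤ Real.log n := Real.log_le_log (by norm_num) (by exact_mod_cast hn)
  have hln : 0 < Real.log n := by linarith
  have hx : 0 ≤ (n : ℝ) ^ (3 / 4 : ℝ) / Real.log n ^ (3 / 2 : ℝ) := by positivity
  rcases le_or_gt n₀ n with h | h
  · exact (mul_le_mul_of_nonneg_right (min_le_left _ _) hx).trans_lt
      (le_fMax_sub_primeCounting (hn₀ n h))
  · have h1 : (n : ℝ) ^ (3 / 4 : ℝ) / Real.log n ^ (3 / 2 : ℝ) ≤ M := by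
      have : (n : ℝ) ≤ n₀ + 1 := by exact_mod_cast (by omega : n ≤ n₀ + 1)
      rw [hM]
      gcongr
    have h2 : ((Nat.primeCounting n + 1 : ℕ) : ℝ) ≤ fMax 6 3 n := by
      exact_mod_cast primeCounting_lt_fMax (by omega : 0 < n)
    push_cast at h2
    calc _ ≤ 1 / (2 * M) * M :=
          mul_le_mul (min_le_right _ _) h1 hx (by positivity)
      _ = 1 / 2 := by field_simp
      _ < _ := by linarith

theorem mainTheorem8 :
    ∃ c₁ c₂ : ℝ, 0 < c₁ ∧ 0 < c₂ ∧ ∀ n : ℕ, 2 ≤ n →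
      c₁ * ((n : ℝ) ^ (3 / 4 : ℝ) / Real.log n ^ (3 / 2 : ℝ))
          < (fMax 6 3 n : ℝ) - (Nat.primeCounting n : ℝ) ∧
      (fMax 6 3 n : ℝ) - (Nat.primeCounting n : ℝ)
          < c₂ * ((n : ℝ) ^ (3 / 4 : ℝ) / Real.log n ^ (3 / 2 : ℝ)) := by
  obtain ⟨c, hc, hlow⟩ := exists_le_fMax_sub_primeCounting
  obtain ⟨C, hC, hup⟩ := exists_card_le_of_mulSidon
  refine ⟨c, C + 1, hc, by linarith, fun n hn => ⟨hlow n hn, ?_⟩⟩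
  obtain ⟨A, hAn, hA, hcard⟩ := (isGreatest_fMax 6 3 n).1
  have h := hup n hn A hAn (mulSidon_of_mem_gammaFamily hA)
  rw [hcard] at h
  have hn1 : (1 : ℝ) < n := by exact_mod_cast (by omega : 1 < n)
  have hln := Real.log_pos hn1
  have hx : 0 < (n : ℝ) ^ (3 / 4 : ℝ) / Real.log n ^ (3 / 2 : ℝ) := by positivity
  linarith
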